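/- A parabolic region is a set $\{My : y\in\mathbb R^2,\ y_1\ge 0,\ |y_2|\le y_1^{\alpha}\}$ with $\alpha>0$ and $M$ a rigid motion of $\mathbb R^2$. Two sets $U,V\subset\mathbb R^2$ are transverse if $$\liminf_{\|x\|\to\infty}\frac{\log\bigl(1+d(x,\partial U)+d(x,\partial V)\bigr)}{\log\|x\|}>0 .$$ The intersection number $\chi_{U,V}\in\mathbb Z$ is defined as follows. Choose a set $\mathcal U\subset\mathbb R^2$, transverse to $V$, with $\mathcal U\cap\mathbb Z^2=U\cap\mathbb Z^2$, whose boundary is a locally finite disjoint union of piecewise regular $C^1$ simple curves that are either closed or proper, all oriented so that $\mathcal U$ lies to their left; let $\gamma_j:\mathbb R\to\mathbb R^2$ be the proper ones, i.e. the unbounded components of $\partial\,\mathcal U$. With $\Lambda_V$ the indicator function of $V$, $$\chi_{U,V}=\sum_j\lim_{t\to+\infty}\bigl(\Lambda_V(\gamma_j(t))-\Lambda_V(\gamma_j(-t))\bigr),$$ where the limits exist and only finitely many of them are non-zero. Proposition. Let $U\subset\mathbb R^2$ be such that both $U$ and $U^c$ contain parabolic regions. Then there is a set $V\subset\mathbb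 R^2$ such that $U$ and $V$ are transverse, $\partial V$ consists of two disjoint rays and the segment joining their endpoints (which meets each ray only at its endpoint), and $\chi_{U,V}$ is well defined (an admissible $\mathcal U$ exists and the sum does not depend on its choice) and equal to $-1$; in particular $\chi_{U,V}\neq 0$. -/

import Mathlib

open Set Filter Topology

noncomputable section

/-- The plane with its Euclidean norm. -/
abbrev Plane : Type := EuclideanSpace ℝ (Fin 2)

/-- The lattice `ℤ²` inside the plane. -/
def integerLattice : Set Plane := {x | ∀ i, ∃ n : ℤ, x i = n}

/-- Counterclockwise rotation by a right angle. -/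
def rotLeft (v : Plane) : Plane := !₂[-v 1, v 0]

/-- Images of `{y₁ ≥ 0, |y₂| ≤ y₁ ^ α}`, `α > 0`, under rigid motions. Since the model region is
symmetric under `y₂ ↦ -y₂`, it does not matter whether reflections are admitted. -/
def IsParabolicRegion (P : Set Plane) : Prop :=
  ∃ (α : ℝ) (M : Plane ≃ᵃⁱ[ℝ] Plane), 0 < α ∧
    P = M '' {y : Plane | 0 ≤ y 0 ∧ |y 1| ≤ y 0 ^ α}

/-- `Ψ_{U,V}(x) = 1 + d(x, ∂U) + d(x, ∂V)`. -/
def boundaryGauge (U V : Set Plane) (x : Plane) : ℝ :=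
  1 + Metric.infDist x (frontier U) + Metric.infDist x (frontier V)

/-- Transverse sets: `liminf_{‖x‖ → ∞} log Ψ_{U,V}(x) / log ‖x‖ > 0`. The lower limit is taken in
the extended reals, so that it always exists. -/
def Transverse (U V : Set Plane) : Prop :=
  0 < liminf (fun x : Plane => ((Real.log (boundaryGauge U V x) / Real.log ‖x‖ : ℝ) : EReal))
    (Bornology.cobounded Plane)

/-- Away from a locally finite set of parameters, `γ` is continuously differentiable with
non-vanishing velocity. -/
def PiecewiseRegular (γ : ℝ → Plane) : Prop :=
  ∃ B : Set ℝ, (∀ a b : ℝ, (B ∩ Icc a b).Finite) ∧ ContDiffOn ℝ 1 γ Bᶜ ∧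
    ∀ t ∉ B, deriv γ t ≠ 0

/-- A proper simple curve `ℝ → ℝ²`, piecewise regular. -/
structure IsProperSimpleCurve (γ : ℝ → Plane) : Prop where
  continuous : Continuous γ
  injective : Function.Injective γ
  proper : Tendsto γ (cocompact ℝ) (cocompact Plane)
  piecewiseRegular : PiecewiseRegular γ

/-- A simple closed curve, piecewise regular, given as a periodic map. -/
structure IsSimpleClosedCurve (γ : ℝ → Plane) : Prop where
  continuous : Continuous γ
  periodic : ∃ T : ℝ, 0 < T ∧ Function.Periodic γ T ∧ InjOn γ (Ico 0 T)
  piecewiseRegular : PiecewiseRegular γ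

/-- The set `S` lies to the left of the oriented curve `γ` (and its complement to the right). -/
def LiesToLeft (S : Set Plane) (γ : ℝ → Plane) : Prop :=
  ∀ (t : ℝ) (v : Plane), HasDerivAt γ v t → v ≠ 0 →
    ∀ᶠ ε : ℝ in 𝓝[>] 0, γ t + ε • rotLeft v ∈ S ∧ γ t - ε • rotLeft v ∉ S

/-- A decomposition of the boundary of `S` into pairwise disjoint simple curves, proper ones
(`line`) and closed ones (`loop`), with `S` to their left. Because the family is locally finite
and disjoint, it is countable, the ranges of these curves are exactly the connected components of
`∂S`, and the ranges of the `line i` are exactly the unbounded ones. -/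
structure BoundaryCurves (S : Set Plane) where
  ι : Type
  κ : Type
  line : ι → ℝ → Plane
  loop : κ → ℝ → Plane
  line_proper : ∀ i, IsProperSimpleCurve (line i)
  loop_closed : ∀ k, IsSimpleClosedCurve (loop k)
  disjoint : Pairwise fun a b : ι ⊕ κ =>
    Disjoint (range (Sum.elim line loop a)) (range (Sum.elim line loop b))
  locallyFinite : LocallyFinite fun a : ι ⊕ κ => range (Sum.elim line loop a)
  frontier_eq : frontier S = ⋃ a : ι ⊕ κ, range (Sum.elim line loop a)
  left : ∀ a : ι ⊕ κ, LiesToLeft S (Sum.elim line loop a)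

/-- The indicator function `Λ_V`, with integer values. -/
def indicatorInt (V : Set Plane) (x : Plane) : ℤ := V.indicator (fun _ => (1 : ℤ)) x

/-- `χ_{U,V} = k`: some set `W`, transverse to `V`, has the same lattice points as `U` and is
bounded by curves as above, the limits `c i` of `Λ_V(γ_i(t)) - Λ_V(γ_i(-t))` as `t → +∞` along its
unbounded boundary components `γ_i` exist, only finitely many of them are non-zero, and they add
up to `k`. -/
def HasIntersectionNumber (U V : Set Plane) (k : ℤ) : Prop :=
  ∃ (W : Set Plane) (D : BoundaryCurves W) (c : D.ι → ℤ),
    W ∩ integerLattice = U ∩ integerLattice ∧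
    Transverse W V ∧
    (∀ i, Tendsto (fun t : ℝ => indicatorInt V (D.line i t) - indicatorInt V (D.line i (-t)))
      atTop (𝓝 (c i))) ∧
    (Function.support c).Finite ∧
    k = ∑ᶠ i, c i

open Classical in
/-- The intersection number `χ_{U,V}` (`0` if it is not defined). -/
def intersectionNumber (U V : Set Plane) : ℤ :=
  if h : ∃ k, HasIntersectionNumber U V k then h.choose else 0

/-- The closed ray from `p` in the direction `u`. -/
def ray (p u : Plane) : Set Plane := {x | ∃ s : ℝ, 0 ≤ s ∧ x = p + s • u}

/-- `Γ` consists of two disjoint rays and the segment joining their endpoints, which meets each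
ray only in its endpoint. -/
def IsTwoRaysJoinedBySegment (Γ : Set Plane) : Prop :=
  ∃ p q u v : Plane, p ≠ q ∧ ‖u‖ = 1 ∧ ‖v‖ = 1 ∧
    Disjoint (ray p u) (ray q v) ∧
    segment ℝ p q ∩ ray p u = {p} ∧
    segment ℝ p q ∩ ray q v = {q} ∧
    Γ = ray p u ∪ segment ℝ p q ∪ ray q v

end

/-! Parabolic regions in `U` and in `Uᶜ` have different axis directions `u ≠ v`, because parallel
axes stay at bounded distance while the regions widen. Let `e` be the unit vector along `u - v`. In
the frame `e, rotLeft e`, the vectors `u` and `v` have opposite abscissas and equal ordinates. Hence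
rays along the two axes, begun far enough out and joined by a segment, form the graph of a function
`f` at bounded distance from `k * √(1 + r ^ 2)` (`exists_graph_of_parabolicRegions`). The set `V` is
the epigraph of `f`. Far to the right the graph is surrounded by discs in `U`, far to the left by
discs in `Uᶜ`, with radius a positive power of the abscissa. So `∂U` stays away from `∂V`, which is
transversality (`transverse_frameEpigraph`).

Every admissible `W` gives the value -1 (`HasIntersectionNumber.eq_neg_one`). Transversality keeps
`∂W` away from the ends of `∂V`, and lattice points near these ends show that the right end lies in
`W` and the left end outside (`Transverse.exists_strip`). Replace `f` by a smooth function `g` at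
bounded distance, shifted by a regular value so that its graph crosses `∂W` transversally
(`exists_crossesTransversally`). The crossings are then counted in two ways. Along the graph, the
jumps of the indicator of `W`, taken from right to left, sum to -1. By the orientation of `∂W`, each
jump is also the sign with which a boundary curve crosses the graph, +1 if upwards
(`CrossesTransversally.spec`). Along a closed curve these signs cancel, and along a proper curve
they sum to its contribution to the intersection number (`CrossesTransversally.finsum_eq`).

An admissible set exists (`hasIntersectionNumber_neg_one`): take a half-plane bounded by a line
parallel to `rotLeft e` that avoids the lattice, and add or remove a small disc about each lattice
point where it disagrees with `U`. Its only proper boundary curve is that line, which runs downwards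
and leaves `V` once. -/

/-! ### Orthonormal frames of the plane -/

/-- The first coordinate of `x` in the frame `e, rotLeft e`. -/
def frameX (e x : Plane) : ℝ := e 0 * x 0 + e 1 * x 1

/-- The second coordinate of `x` in the frame `e, rotLeft e`. -/
def frameY (e x : Plane) : ℝ := e 0 * x 1 - e 1 * x 0

/-- The point with coordinates `a, b` in the frame `e, rotLeft e`. -/
noncomputable def framePoint (e : Plane) (a b : ℝ) : Plane := a • e + b • rotLeft e

@[simp] lemma rotLeft_zero (v : Plane) : rotLeft v 0 = -v 1 := by simp [rotLeft]
@[simp] lemma rotLeft_one (v : Plane) : rotLeft v 1 = v 0 := by simp [rotLeft]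

@[simp] lemma framePoint_zero (e : Plane) (a b : ℝ) :
    framePoint e a b 0 = a * e 0 - b * e 1 := by simp [framePoint]; ring
@[simp] lemma framePoint_one (e : Plane) (a b : ℝ) :
    framePoint e a b 1 = a * e 1 + b * e 0 := by simp [framePoint]

lemma Plane.ext {x y : Plane} (h0 : x 0 = y 0) (h1 : x 1 = y 1) : x = y := by
  ext i; fin_cases i <;> assumption

lemma Plane.norm_sq (x : Plane) : ‖x‖ ^ 2 = x 0 ^ 2 + x 1 ^ 2 := by
  simp [EuclideanSpace.norm_sq_eq, Fin.sum_univ_two]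

lemma Plane.inner_eq (x y : Plane) : inner ℝ x y = x 0 * y 0 + x 1 * y 1 := by
  simp [PiLp.inner_apply, Fin.sum_univ_two]; ring

lemma frame_sq {e : Plane} (he : ‖e‖ = 1) : e 0 ^ 2 + e 1 ^ 2 = 1 := by
  rw [← Plane.norm_sq, he]; norm_num

lemma frameX_framePoint {e : Plane} (he : ‖e‖ = 1) (a b : ℝ) :
    frameX e (framePoint e a b) = a := by
  have := frame_sq he
  simp only [frameX, framePoint_zero, framePoint_one]; linear_combination a * this

lemma frameY_framePoint {e : Plane} (he : ‖e‖ = 1) (a b : ℝ) :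
    frameY e (framePoint e a b) = b := by
  have := frame_sq he
  simp only [frameY, framePoint_zero, framePoint_one]; linear_combination b * this

lemma framePoint_frame {e : Plane} (he : ‖e‖ = 1) (x : Plane) :
    framePoint e (frameX e x) (frameY e x) = x := by
  have := frame_sq he
  apply Plane.ext
  · simp only [frameX, frameY, framePoint_zero]; linear_combination x 0 * this
  · simp only [frameX, frameY, framePoint_one]; linear_combination x 1 * this

lemma frameX_add (e x y : Plane) : frameX e (x + y) = frameX e x + frameX e y := by
  simp [frameX]; ring
lemma frameY_add (e x y : Plane) : frameY e (x + y) = frameY e x + frameY e y := by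
  simp [frameY]; ring
lemma frameX_sub (e x y : Plane) : frameX e (x - y) = frameX e x - frameX e y := by
  simp [frameX]; ring
lemma frameY_sub (e x y : Plane) : frameY e (x - y) = frameY e x - frameY e y := by
  simp [frameY]; ring
lemma frameX_smul (e : Plane) (s : ℝ) (x : Plane) : frameX e (s • x) = s * frameX e x := by
  simp [frameX]; ring
lemma frameY_smul (e : Plane) (s : ℝ) (x : Plane) : frameY e (s • x) = s * frameY e x := by
  simp [frameY]; ring

lemma continuous_frameX (e : Plane) : Continuous (frameX e) := by
  unfold frameX; fun_prop
lemma continuous_frameY (e : Plane) : Continuous (frameY e) := by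
  unfold frameY; fun_prop
lemma continuous_framePoint (e : Plane) : Continuous fun p : ℝ × ℝ => framePoint e p.1 p.2 := by
  unfold framePoint; fun_prop

lemma norm_sq_eq_frame {e : Plane} (he : ‖e‖ = 1) (x : Plane) :
    ‖x‖ ^ 2 = frameX e x ^ 2 + frameY e x ^ 2 := by
  have := frame_sq he
  rw [Plane.norm_sq]; simp only [frameX, frameY]
  linear_combination (-(x 0 ^ 2 + x 1 ^ 2)) * this

lemma norm_rotLeft (v : Plane) : ‖rotLeft v‖ = ‖v‖ := by
  rw [← sq_eq_sq₀ (norm_nonneg _) (norm_nonneg _), Plane.norm_sq, Plane.norm_sq]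
  simp; ring

lemma abs_frameX_le {e : Plane} (he : ‖e‖ = 1) (x : Plane) : |frameX e x| ≤ ‖x‖ := by
  apply abs_le_of_sq_le_sq _ (norm_nonneg _)
  rw [norm_sq_eq_frame he]; nlinarith [sq_nonneg (frameY e x)]

lemma abs_frameX_sub_le {e : Plane} (he : ‖e‖ = 1) (x y : Plane) :
    |frameX e x - frameX e y| ≤ dist x y := by
  rw [dist_eq_norm, ← frameX_sub]; exact abs_frameX_le he _

lemma norm_le_frame {e : Plane} (he : ‖e‖ = 1) (x : Plane) :
    ‖x‖ ≤ |frameX e x| + |frameY e x| := by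
  apply le_of_sq_le_sq _ (by positivity)
  rw [norm_sq_eq_frame he]
  nlinarith [sq_abs (frameX e x), sq_abs (frameY e x),
    mul_nonneg (abs_nonneg (frameX e x)) (abs_nonneg (frameY e x))]

lemma dist_framePoint_right {e : Plane} (he : ‖e‖ = 1) (a b c : ℝ) :
    dist (framePoint e a b) (framePoint e a c) = |b - c| := by
  have : framePoint e a b - framePoint e a c = (b - c) • rotLeft e := by
    simp [framePoint, sub_smul]
  rw [dist_eq_norm, this, norm_smul, norm_rotLeft, he, mul_one, Real.norm_eq_abs]

lemma abs_le_norm_framePoint {e : Plane} (he : ‖e‖ = 1) (a b : ℝ) : |a| ≤ ‖framePoint e a b‖ := by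
  simpa [frameX_framePoint he] using abs_frameX_le he (framePoint e a b)

/-! ### Graphs over the first axis of a frame -/

/-- The epigraph of `f` in the frame `e, rotLeft e`. -/
def frameEpigraph (e : Plane) (f : ℝ → ℝ) : Set Plane := {x | f (frameX e x) ≤ frameY e x}

/-- The graph of `f` in the frame `e, rotLeft e`. -/
def frameGraph (e : Plane) (f : ℝ → ℝ) : Set Plane := {x | frameY e x = f (frameX e x)}

lemma framePoint_mem_frameGraph {e : Plane} (he : ‖e‖ = 1) (f : ℝ → ℝ) (r : ℝ) :
    framePoint e r (f r) ∈ frameGraph e f := by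
  simp [frameGraph, frameX_framePoint he, frameY_framePoint he]

lemma frontier_frameEpigraph {e : Plane} (he : ‖e‖ = 1) {f : ℝ → ℝ} (hf : Continuous f) :
    frontier (frameEpigraph e f) = frameGraph e f := by
  have hX := continuous_frameX e
  have hY := continuous_frameY e
  apply Subset.antisymm
  · intro x hx
    exact (frontier_le_subset_eq (hf.comp hX) hY hx).symm
  · intro x hx
    have hx' : frameY e x = f (frameX e x) := hx
    rw [frontier_eq_closure_inter_closure]
    refine ⟨subset_closure hx'.ge, ?_⟩
    have hc : Tendsto (fun ε : ℝ => framePoint e (frameX e x) (frameY e x - ε)) (𝓝[>] 0) (𝓝 x) := by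
      have : Continuous fun ε : ℝ => framePoint e (frameX e x) (frameY e x - ε) := by
        unfold framePoint; fun_prop
      have h := this.tendsto 0
      simp only [sub_zero, framePoint_frame he] at h
      exact h.mono_left nhdsWithin_le_nhds
    refine mem_closure_of_tendsto hc ?_
    filter_upwards [self_mem_nhdsWithin] with ε hε
    have : 0 < ε := hε
    simp only [frameEpigraph, mem_compl_iff, mem_ofPred_eq, frameX_framePoint he,
      frameY_framePoint he, not_le]
    linarith

/-! ### Counting jumps of integer valued functions -/

/-- Subtracting the jumps accumulated before `x`, and using the left limit `B` at the jump points
themselves, turns `φ` into a locally constant function on `[a, b]`, hence a constant one. The values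
of `φ` on `Z` play no role. -/
lemma jump_sum {φ A B : ℝ → ℤ} {a b : ℝ} (hab : a ≤ b) {Z : Finset ℝ}
    (hZ : ∀ t ∈ Z, a < t ∧ t < b)
    (hc : ∀ t ∈ Icc a b, t ∉ Z → ∀ᶠ x in 𝓝 t, φ x = φ t)
    (hA : ∀ t ∈ Z, ∀ᶠ x in 𝓝[>] t, φ x = A t)
    (hB : ∀ t ∈ Z, ∀ᶠ x in 𝓝[<] t, φ x = B t) :
    φ b - φ a = ∑ t ∈ Z, (A t - B t) := by
  classical
  set F : ℝ → ℤ := fun x => (if x ∈ Z then B x else φ x) - ∑ t ∈ Z with t < x, (A t - B t)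
    with hF
  have key : ∀ t, ∀ᶠ x in 𝓝 t, ∀ s ∈ Z, s ≠ t → x ≠ s ∧ (s < x ↔ s < t) := by
    intro t
    rw [Finset.eventually_all]
    intro s _
    rcases lt_trichotomy s t with h | h | h
    · filter_upwards [lt_mem_nhds h] with x hx _
      exact ⟨hx.ne', iff_of_true hx h⟩
    · simp [h]
    · filter_upwards [gt_mem_nhds h] with x hx _
      exact ⟨hx.ne, iff_of_false hx.not_gt h.not_gt⟩
  have hFc : ContinuousOn F (Icc a b) := by
    intro t ht
    apply ContinuousAt.continuousWithinAt
    refine (continuousAt_const (y := F t)).congr ?_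
    by_cases htZ : t ∈ Z
    · have h1 : ∀ᶠ x in 𝓝 t, t < x → φ x = A t := eventually_nhdsWithin_iff.1 (hA t htZ)
      have h2 : ∀ᶠ x in 𝓝 t, x < t → φ x = B t := eventually_nhdsWithin_iff.1 (hB t htZ)
      filter_upwards [h1, h2, key t] with x hxA hxB hk
      rcases lt_trichotomy x t with h | h | h
      · have hxZ : x ∉ Z := fun hx => (hk x hx h.ne).1 rfl
        have : (Z.filter (· < x)) = Z.filter (· < t) := by
          apply Finset.filter_congr
          intro s hs
          by_cases hst : s = t
          · subst hst; simp [h.le]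
          · exact (hk s hs hst).2
        simp only [hF, htZ, hxZ, if_true, if_false, hxB h, this]
      · rw [h]
      · have hxZ : x ∉ Z := fun hx => (hk x hx h.ne').1 rfl
        have : (Z.filter (· < x)) = insert t (Z.filter (· < t)) := by
          ext s
          simp only [Finset.mem_filter, Finset.mem_insert]
          by_cases hst : s = t
          · subst hst; simp [htZ, h]
          · simp only [hst, false_or]
            exact and_congr_right fun hs => (hk s hs hst).2
        simp only [hF, htZ, hxZ, if_true, if_false, hxA h, this]
        rw [Finset.sum_insert (by simp)]
        ring
    · filter_upwards [hc t ht htZ, key t] with x hx hk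
      have hne : ∀ s ∈ Z, s ≠ t := fun s hs h => htZ (h ▸ hs)
      have hxZ : x ∉ Z := fun h => (hk x h (hne x h)).1 rfl
      have : (Z.filter (· < x)) = Z.filter (· < t) :=
        Finset.filter_congr fun s hs => (hk s hs (hne s hs)).2
      simp only [hF, htZ, hxZ, if_false, hx, this]
  have h := isPreconnected_Icc.constant hFc (left_mem_Icc.2 hab) (right_mem_Icc.2 hab)
  have haZ : a ∉ Z := fun h => (hZ a h).1.false
  have hbZ : b ∉ Z := fun h => (hZ b h).2.false
  have e1 : Z.filter (· < a) = ∅ := by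
    apply Finset.filter_false_of_mem; intro s hs; exact (hZ s hs).1.le.not_gt
  have e2 : Z.filter (· < b) = Z := Finset.filter_true_of_mem fun s hs => (hZ s hs).2
  simp only [hF, haZ, hbZ, if_false, e1, e2, Finset.sum_empty] at h
  linarith

lemma eventually_pos_of_deriv_pos {h : ℝ → ℝ} {d t : ℝ} (hd : HasDerivAt h d t) (h0 : h t = 0)
    (hpos : 0 < d) : (∀ᶠ x in 𝓝[>] t, 0 < h x) ∧ ∀ᶠ x in 𝓝[<] t, h x < 0 := by
  have hs := (hasDerivAt_iff_tendsto_slope.1 hd).eventually (lt_mem_nhds hpos)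
  rw [eventually_nhdsWithin_iff] at hs
  constructor
  · rw [eventually_nhdsWithin_iff]
    filter_upwards [hs] with x hx hxt
    have hxt' : t < x := hxt
    have := hx hxt'.ne'
    rw [slope_def_field, h0, sub_zero] at this
    exact (div_pos_iff_of_pos_right (sub_pos.2 hxt')).1 this
  · rw [eventually_nhdsWithin_iff]
    filter_upwards [hs] with x hx hxt
    have hxt' : x < t := hxt
    have := hx hxt'.ne
    rw [slope_def_field, h0, sub_zero] at this
    by_contra hcon
    exact absurd this (not_lt.2 (div_nonpos_of_nonneg_of_nonpos (not_lt.1 hcon) (by linarith)))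

/-- The signed number of zeros of a function with simple zeros only is its change of sign. -/
lemma sign_change_eq_sum {h : ℝ → ℝ} (hcont : Continuous h) {a b : ℝ} (hab : a ≤ b)
    {Z : Finset ℝ} (hZ : ∀ t, t ∈ Z ↔ t ∈ Ioo a b ∧ h t = 0) (ha : h a ≠ 0) (hb : h b ≠ 0)
    (hd : ∀ t ∈ Z, DifferentiableAt ℝ h t ∧ deriv h t ≠ 0) :
    (if 0 ≤ h b then (1 : ℤ) else 0) - (if 0 ≤ h a then (1 : ℤ) else 0)
      = ∑ t ∈ Z, (if 0 < deriv h t then (1 : ℤ) else -1) := by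
  have key : ∀ t ∈ Z, (∀ᶠ x in 𝓝[>] t,
        (if 0 ≤ h x then (1 : ℤ) else 0) = if 0 < deriv h t then 1 else 0) ∧
      ∀ᶠ x in 𝓝[<] t, (if 0 ≤ h x then (1 : ℤ) else 0) = if 0 < deriv h t then 0 else 1 := by
    intro t ht
    obtain ⟨hdt, hne⟩ := hd t ht
    have h0 := ((hZ t).1 ht).2
    rcases hne.lt_or_gt with hlt | hgt
    · obtain ⟨h1, h2⟩ := eventually_pos_of_deriv_pos (h := fun x => -h x) hdt.hasDerivAt.neg
        (by simp [h0]) (by linarith)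
      constructor
      · filter_upwards [h1] with x hx
        rw [if_neg (by linarith), if_neg hlt.le.not_gt]
      · filter_upwards [h2] with x hx
        rw [if_pos (by linarith), if_neg hlt.le.not_gt]
    · obtain ⟨h1, h2⟩ := eventually_pos_of_deriv_pos hdt.hasDerivAt h0 hgt
      constructor
      · filter_upwards [h1] with x hx
        rw [if_pos hx.le, if_pos hgt]
      · filter_upwards [h2] with x hx
        rw [if_neg (by linarith), if_pos hgt]
  rw [jump_sum (φ := fun x => if 0 ≤ h x then (1 : ℤ) else 0) hab
    (fun t ht => ((hZ t).1 ht).1) ?_ (fun t ht => (key t ht).1) (fun t ht => (key t ht).2)]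
  · apply Finset.sum_congr rfl
    intro t _
    split_ifs <;> norm_num
  · intro t ht htZ
    have hne : h t ≠ 0 := by
      intro h0
      rcases eq_or_lt_of_le ht.1 with h1 | h1
      · exact ha (h1 ▸ h0)
      rcases eq_or_lt_of_le ht.2 with h2 | h2
      · exact hb (h2 ▸ h0)
      exact htZ ((hZ t).2 ⟨⟨h1, h2⟩, h0⟩)
    rcases hne.lt_or_gt with hlt | hgt
    · filter_upwards [hcont.continuousAt.eventually (gt_mem_nhds hlt)] with x hx
      rw [if_neg hx.not_ge, if_neg hlt.not_ge]
    · filter_upwards [hcont.continuousAt.eventually (lt_mem_nhds hgt)] with x hx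
      rw [if_pos hx.le, if_pos hgt.le]

/-- Zeros at which the derivative does not vanish form a discrete set. -/
lemma finite_zeros_Icc {h : ℝ → ℝ} (hcont : Continuous h)
    (hd : ∀ t, h t = 0 → DifferentiableAt ℝ h t ∧ deriv h t ≠ 0) (a b : ℝ) :
    (Icc a b ∩ {t | h t = 0}).Finite := by
  have hK : IsCompact (Icc a b ∩ {t | h t = 0}) :=
    isCompact_Icc.inter_right (isClosed_eq hcont continuous_const)
  by_contra hinf
  obtain ⟨t, ht, hacc⟩ := Set.Infinite.exists_accPt_of_subset_isCompact hinf hK subset_rfl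
  obtain ⟨h1, h2⟩ := hd t ht.2
  have := h1.hasDerivAt.eventually_ne (c := 0) h2
  rw [accPt_iff_frequently_nhdsNE] at hacc
  exact hacc (this.mono fun x hx hm => hx hm.2)

/-! ### Critical values -/

/-- The one-dimensional Sard theorem. It needs differentiability only at the critical points
themselves, so it applies to heights along curves that are merely piecewise regular. -/
lemma volume_critical_values_eq_zero (h : ℝ → ℝ) :
    MeasureTheory.volume (h '' {t | DifferentiableAt ℝ h t ∧ deriv h t = 0}) = 0 := by
  apply MeasureTheory.addHaar_image_eq_zero_of_det_fderivWithin_eq_zero MeasureTheory.volume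
    (f' := fun _ => (0 : ℝ →L[ℝ] ℝ))
  · intro t ht
    have h1 := ht.1.hasDerivAt
    rw [ht.2] at h1
    have h2 := h1.hasFDerivAt.hasFDerivWithinAt (s := {t | DifferentiableAt ℝ h t ∧ deriv h t = 0})
    have h3 : ContinuousLinearMap.toSpanSingleton ℝ (0 : ℝ) = 0 := by ext; simp
    rw [h3] at h2
    exact h2
  · intro t _
    simp [ContinuousLinearMap.det]

/-! ### Sets and connected sets that do not meet their boundary -/

lemma IsPreconnected.mem_iff_of_disjoint_frontier {α : Type*} [TopologicalSpace α] {T S : Set α}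
    (hT : IsPreconnected T) (hd : ∀ x ∈ T, x ∉ frontier S) {x y : α} (hx : x ∈ T) (hy : y ∈ T) :
    x ∈ S ↔ y ∈ S := by
  have hsub : T ⊆ interior S ∪ interior Sᶜ := by
    intro z hz
    have := hd z hz
    rw [frontier_eq_closure_inter_closure, mem_inter_iff, not_and_or] at this
    rw [interior_compl, ← compl_compl S, interior_compl, compl_compl]
    exact this.symm
  rcases hT.subset_or_subset isOpen_interior isOpen_interior
    (disjoint_compl_right.mono interior_subset interior_subset) hsub with h | h
  · exact iff_of_true (interior_subset (h hx)) (interior_subset (h hy))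
  · exact iff_of_false (interior_subset (h hx)) (interior_subset (h hy))

lemma eventually_mem_iff_of_notMem_frontier {α : Type*} [TopologicalSpace α] {S : Set α} {x : α}
    (hx : x ∉ frontier S) : ∀ᶠ y in 𝓝 x, y ∈ S ↔ x ∈ S := by
  rw [frontier_eq_closure_inter_closure, mem_inter_iff, not_and_or] at hx
  rcases hx with h | h
  · filter_upwards [isClosed_closure.isOpen_compl.mem_nhds h] with y hy
    exact iff_of_false (fun h' => hy (subset_closure h')) (fun h' => h (subset_closure h'))
  · filter_upwards [isClosed_closure.isOpen_compl.mem_nhds h] with y hy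
    exact iff_of_true (by_contra fun h' => hy (subset_closure h'))
      (by_contra fun h' => h (subset_closure h'))

/-- If, near `x`, the boundary of `S` is tangent to the orthogonal of `n`, then a curve which
leaves `x` in a direction `d` on the same side as `n` is off the boundary, on the side of `n`. -/
lemma eventually_mem_iff_of_tangent_frontier {S : Set Plane} {x n d : Plane}
    (htan : ∀ η > 0, ∀ᶠ y in 𝓝 x, y ∈ frontier S → |inner ℝ n (y - x)| ≤ η * ‖y - x‖)
    {F : ℝ → Plane} (hF : HasDerivWithinAt F d (Ioi 0) 0) (hF0 : F 0 = x)
    (hnd : 0 < inner ℝ n d) :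
    ∀ᶠ ε in 𝓝[>] (0 : ℝ), F ε ∉ frontier S ∧ (F ε ∈ S ↔ x + ε • n ∈ S) := by
  have hn : 0 < inner ℝ n n := by
    rw [real_inner_self_eq_norm_sq]
    have : n ≠ 0 := by rintro rfl; simp at hnd
    positivity
  have hslope : Tendsto (fun ε : ℝ => ε⁻¹ • (F ε - x)) (𝓝[>] 0) (𝓝 d) := by
    have := (hasDerivWithinAt_iff_tendsto_slope' (by simp)).1 hF
    refine this.congr fun ε => ?_
    simp [slope, hF0]
  set m := min (inner ℝ n d / 2) (inner ℝ n n) with hm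
  have hmpos : 0 < m := lt_min (by positivity) hn
  set K := ‖d‖ + 1 + ‖n‖ with hK
  have hKpos : 0 < K := by positivity
  have h1 : ∀ᶠ ε in 𝓝[>] (0 : ℝ), m ≤ inner ℝ n (ε⁻¹ • (F ε - x)) := by
    have : Tendsto (fun ε : ℝ => inner ℝ n (ε⁻¹ • (F ε - x))) (𝓝[>] 0) (𝓝 (inner ℝ n d)) :=
      tendsto_const_nhds.inner hslope
    refine (this.eventually (lt_mem_nhds (half_lt_self hnd))).mono fun ε h => ?_
    exact (min_le_left _ _).trans h.le
  have h2 : ∀ᶠ ε in 𝓝[>] (0 : ℝ), ‖ε⁻¹ • (F ε - x)‖ ≤ K := by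
    refine (hslope.norm.eventually (gt_mem_nhds (lt_add_one ‖d‖))).mono fun ε h => ?_
    have := norm_nonneg n
    linarith
  obtain ⟨δ, hδ, hball⟩ := Metric.eventually_nhds_iff.1 (htan (m / (2 * K)) (by positivity))
  have h3 : ∀ᶠ ε in 𝓝[>] (0 : ℝ), ε < δ / K := by
    apply eventually_nhdsWithin_of_eventually_nhds
    exact gt_mem_nhds (by positivity)
  filter_upwards [h1, h2, h3, self_mem_nhdsWithin] with ε e1 e2 e3 e4
  have hε : 0 < ε := e4
  rw [inner_smul_right] at e1
  rw [norm_smul, norm_inv, Real.norm_of_nonneg hε.le] at e2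
  -- Both `F ε` and `x + ε • n` have `n`-component at least `m * ε` and distance at most `K * ε`
  -- from `x`, so they lie in the convex cap `T`. The tangency bound with `η = m / (2 * K)` allows
  -- boundary points in the ball an `n`-component of at most `m * ε / 2`, so `T` misses the
  -- boundary.
  set T : Set Plane := {y | m * ε ≤ inner ℝ n (y - x)} ∩ Metric.closedBall x (K * ε) with hT
  have hconv : Convex ℝ T := by
    apply Convex.inter _ (convex_closedBall _ _)
    intro y hy z hz a b ha hb hab
    simp only [mem_ofPred_eq] at hy hz ⊢
    have : a • y + b • z - x = a • (y - x) + b • (z - x) := by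
      rw [smul_sub, smul_sub]
      have : x = a • x + b • x := by rw [← add_smul, hab, one_smul]
      nth_rewrite 1 [this]; abel
    rw [this, inner_add_right, inner_smul_right, inner_smul_right]
    calc m * ε = a * (m * ε) + b * (m * ε) := by rw [← add_mul, hab, one_mul]
      _ ≤ _ := by gcongr
  have hTf : ∀ y ∈ T, y ∉ frontier S := by
    rintro y ⟨hy1, hy2⟩ hyf
    have hy1' : m * ε ≤ inner ℝ n (y - x) := hy1
    have hyd : dist y x < δ := lt_of_le_of_lt hy2 (by
      rw [lt_div_iff₀ hKpos] at e3; linarith)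
    have h := hball hyd hyf
    rw [← dist_eq_norm] at h
    have h' : m / (2 * K) * dist y x ≤ m / (2 * K) * (K * ε) := by
      gcongr; exact hy2
    have h'' : m / (2 * K) * (K * ε) = m * ε / 2 := by field_simp
    have := le_abs_self (inner ℝ n (y - x))
    have : 0 < m * ε := by positivity
    linarith
  have hFT : F ε ∈ T := by
    refine ⟨?_, ?_⟩
    · change m * ε ≤ _
      calc m * ε ≤ ε⁻¹ * inner ℝ n (F ε - x) * ε := by gcongr
        _ = _ := by field_simp
    · rw [Metric.mem_closedBall, dist_eq_norm]
      calc _ = ε⁻¹ * ‖F ε - x‖ * ε := by field_simp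
        _ ≤ _ := by gcongr
  have hnT : x + ε • n ∈ T := by
    refine ⟨?_, ?_⟩
    · change m * ε ≤ _
      rw [add_sub_cancel_left, inner_smul_right, mul_comm m]
      gcongr
      exact min_le_right _ _
    · rw [Metric.mem_closedBall, dist_eq_norm, add_sub_cancel_left, norm_smul,
        Real.norm_of_nonneg hε.le, mul_comm]
      gcongr
      have := norm_nonneg d
      linarith
  exact ⟨hTf _ hFT, hconv.isPreconnected.mem_iff_of_disjoint_frontier hTf hFT hnT⟩

/-! ### Boundary curves -/

lemma PiecewiseRegular.exists_countable {γ : ℝ → Plane} (h : PiecewiseRegular γ) :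
    ∃ B : Set ℝ, B.Countable ∧ ∀ t ∉ B, DifferentiableAt ℝ γ t ∧ deriv γ t ≠ 0 := by
  obtain ⟨B, hB, -, hd⟩ := h
  -- `deriv` is zero where the derivative does not exist, so its non-vanishing already implies
  -- differentiability.
  refine ⟨B, ?_, fun t ht => ⟨differentiableAt_of_deriv_ne_zero (hd t ht), hd t ht⟩⟩
  have : B = ⋃ n : ℕ, B ∩ Icc (-(n : ℝ)) n := by
    ext t
    simp only [mem_iUnion, mem_inter_iff, exists_and_left, mem_Icc, iff_self_and]
    intro _
    obtain ⟨n, hn⟩ := exists_nat_ge |t|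
    exact ⟨n, abs_le.1 hn⟩
  rw [this]
  exact countable_iUnion fun n => (hB _ _).countable

lemma IsProperSimpleCurve.isClosedMap {γ : ℝ → Plane} (h : IsProperSimpleCurve γ) :
    IsClosedMap γ :=
  (isProperMap_iff_tendsto_cocompact.2 ⟨h.continuous, h.proper⟩).isClosedMap

/-- A proper curve is a closed map, so the image of the parameters away from `t` is closed; by
injectivity it misses `γ t`. Thus distant parts of the curve do not return near `γ t`, and the
tangent at `t` controls the whole range locally. -/
lemma IsProperSimpleCurve.eventually_exists_eq {γ : ℝ → Plane} (h : IsProperSimpleCurve γ) (t : ℝ)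
    {N : Set ℝ} (hN : N ∈ 𝓝 t) : ∀ᶠ y in 𝓝 (γ t), y ∈ range γ → ∃ s ∈ N, γ s = y := by
  have hcl : IsClosed (γ '' (interior N)ᶜ) := h.isClosedMap _ isOpen_interior.isClosed_compl
  have hmem : γ t ∉ γ '' (interior N)ᶜ := by
    rintro ⟨s, hs, hst⟩
    rw [h.injective hst] at hs
    exact hs (mem_interior_iff_mem_nhds.2 hN)
  filter_upwards [hcl.isOpen_compl.mem_nhds hmem]
  rintro y hy ⟨s, rfl⟩
  by_contra hcon
  exact hy ⟨s, fun hs => hcon ⟨s, interior_subset hs, rfl⟩, rfl⟩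

lemma eq_add_int_mul_of_periodic {γ : ℝ → Plane} {T : ℝ} (hT : 0 < T) (hp : Function.Periodic γ T)
    (hinj : InjOn γ (Ico 0 T)) {s t : ℝ} (h : γ s = γ t) : ∃ n : ℤ, s = t + n * T := by
  have hmod : ∀ x, γ (toIcoMod hT 0 x) = γ x := fun x => by
    rw [toIcoMod]
    simpa using hp.sub_zsmul_eq (x := x) (toIcoDiv hT 0 x)
  have hm : ∀ x, toIcoMod hT 0 x ∈ Ico 0 T := fun x => by
    simpa using toIcoMod_mem_Ico hT 0 x
  have := hinj (hm s) (hm t) (by rw [hmod, hmod, h])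
  refine ⟨toIcoDiv hT 0 s - toIcoDiv hT 0 t, ?_⟩
  rw [toIcoMod, toIcoMod] at this
  simp only [zsmul_eq_mul] at this
  push_cast
  linarith

lemma IsSimpleClosedCurve.eventually_exists_eq {γ : ℝ → Plane} (h : IsSimpleClosedCurve γ) (t : ℝ)
    {N : Set ℝ} (hN : N ∈ 𝓝 t) : ∀ᶠ y in 𝓝 (γ t), y ∈ range γ → ∃ s ∈ N, γ s = y := by
  obtain ⟨T, hT, hp, hinj⟩ := h.periodic
  -- One period centred at `t` already covers the curve; it is compact, and it contains no translate
  -- of `t` by a non-zero multiple of `T`.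
  have hcl : IsClosed (γ '' (Icc (t - T / 2) (t + T / 2) ∩ (interior N)ᶜ)) :=
    ((isCompact_Icc.inter_right isOpen_interior.isClosed_compl).image h.continuous).isClosed
  have hmem : γ t ∉ γ '' (Icc (t - T / 2) (t + T / 2) ∩ (interior N)ᶜ) := by
    rintro ⟨s, ⟨hs1, hs2⟩, hst⟩
    obtain ⟨n, rfl⟩ := eq_add_int_mul_of_periodic hT hp hinj hst
    have hn : n = 0 := by
      have h1 : (n : ℝ) < 1 := by nlinarith [hs1.2]
      have h2 : (-1 : ℝ) < n := by nlinarith [hs1.1]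
      have h1' : n < 1 := by exact_mod_cast h1
      have h2' : -1 < n := by exact_mod_cast h2
      omega
    apply hs2
    simpa [hn] using mem_interior_iff_mem_nhds.2 hN
  filter_upwards [hcl.isOpen_compl.mem_nhds hmem]
  rintro y hy ⟨s, rfl⟩
  by_contra hcon
  have hs : γ (toIcoMod hT (t - T / 2) s) = γ s := by
    rw [toIcoMod]
    simpa using hp.sub_zsmul_eq (x := s) (toIcoDiv hT (t - T / 2) s)
  have hm := toIcoMod_mem_Ico hT (t - T / 2) s
  refine hy ⟨_, ⟨⟨hm.1, by linarith [hm.2]⟩, fun hs' => hcon ⟨_, interior_subset hs', hs⟩⟩, hs⟩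

namespace BoundaryCurves

variable {S : Set Plane} (D : BoundaryCurves S)

/-- All boundary curves, proper or closed. -/
def curve (a : D.ι ⊕ D.κ) : ℝ → Plane := Sum.elim D.line D.loop a

lemma continuous_curve (a : D.ι ⊕ D.κ) : Continuous (D.curve a) := by
  rcases a with i | k
  · exact (D.line_proper i).continuous
  · exact (D.loop_closed k).continuous

lemma piecewiseRegular_curve (a : D.ι ⊕ D.κ) : PiecewiseRegular (D.curve a) := by
  rcases a with i | k
  · exact (D.line_proper i).piecewiseRegular
  · exact (D.loop_closed k).piecewiseRegular

lemma eventually_exists_eq (a : D.ι ⊕ D.κ) (t : ℝ) {N : Set ℝ} (hN : N ∈ 𝓝 t) :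
    ∀ᶠ y in 𝓝 (D.curve a t), y ∈ range (D.curve a) → ∃ s ∈ N, D.curve a s = y := by
  rcases a with i | k
  · exact (D.line_proper i).eventually_exists_eq t hN
  · exact (D.loop_closed k).eventually_exists_eq t hN

lemma isClosed_range (a : D.ι ⊕ D.κ) : IsClosed (range (D.curve a)) := by
  rcases a with i | k
  · exact (D.line_proper i).isClosedMap.isClosed_range
  · obtain ⟨T, hT, hp, -⟩ := (D.loop_closed k).periodic
    have : range (D.curve (Sum.inr k)) = D.loop k '' Icc 0 (0 + T) := (hp.image_Icc hT 0).symm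
    rw [this]
    exact (isCompact_Icc.image (D.loop_closed k).continuous).isClosed

lemma mem_frontier_iff {x : Plane} : x ∈ frontier S ↔ ∃ a t, D.curve a t = x := by
  rw [D.frontier_eq]
  simp [curve]

lemma curve_mem_frontier (a : D.ι ⊕ D.κ) (t : ℝ) : D.curve a t ∈ frontier S :=
  D.mem_frontier_iff.2 ⟨a, t, rfl⟩

lemma curve_index_unique {a b : D.ι ⊕ D.κ} {s t : ℝ} (h : D.curve a s = D.curve b t) : a = b := by
  by_contra hne
  exact (Set.disjoint_left.1 (D.disjoint hne)) ⟨s, rfl⟩ ⟨t, h.symm⟩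

lemma countable_index : Countable (D.ι ⊕ D.κ) := by
  rw [← Set.countable_univ_iff]
  exact D.locallyFinite.countable_univ fun a => range_nonempty _

/-- Near a point of a boundary curve, there are no other boundary points. -/
lemma eventually_mem_range (a : D.ι ⊕ D.κ) (t : ℝ) :
    ∀ᶠ y in 𝓝 (D.curve a t), y ∈ frontier S → y ∈ range (D.curve a) := by
  have hlf : LocallyFinite fun b : {b : D.ι ⊕ D.κ // b ≠ a} => range (D.curve b) :=
    D.locallyFinite.comp_injective Subtype.val_injective
  have hcl := hlf.isClosed_iUnion fun b => D.isClosed_range b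
  have hmem : D.curve a t ∉ ⋃ b : {b : D.ι ⊕ D.κ // b ≠ a}, range (D.curve b) := by
    rw [mem_iUnion]
    rintro ⟨b, s, hs⟩
    exact b.2 (D.curve_index_unique hs)
  filter_upwards [hcl.isOpen_compl.mem_nhds hmem] with y hy hyf
  obtain ⟨b, s, rfl⟩ := D.mem_frontier_iff.1 hyf
  by_cases hb : b = a
  · subst hb; exact ⟨s, rfl⟩
  · exact absurd (mem_iUnion.2 ⟨(⟨b, hb⟩ : {b : D.ι ⊕ D.κ // b ≠ a}), mem_range_self s⟩) hy

/-- At a regular point, the boundary is tangent to the boundary curve. -/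
lemma eventually_tangent (a : D.ι ⊕ D.κ) {t : ℝ} {v : Plane} (hv : HasDerivAt (D.curve a) v t)
    (hv0 : v ≠ 0) {η : ℝ} (hη : 0 < η) :
    ∀ᶠ y in 𝓝 (D.curve a t), y ∈ frontier S →
      |inner ℝ (rotLeft v) (y - D.curve a t)| ≤ η * ‖y - D.curve a t‖ := by
  have hvn : 0 < ‖v‖ := norm_pos_iff.2 hv0
  -- The error of the linear approximation is at most `c * ‖s - t‖`. The bound `c ≤ ‖v‖ / 2` gives
  -- `‖s - t‖ * ‖v‖ ≤ 2 * ‖w‖`, and `c ≤ η / 2` bounds the normal component of `w` by `η * ‖v‖ * ‖s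
  -- - t‖ / 2`.
  set c := min (‖v‖ / 2) (η / 2) with hc
  have hcpos : 0 < c := by positivity
  have hlit := (hasDerivAt_iff_isLittleO.1 hv).def hcpos
  filter_upwards [D.eventually_mem_range a t, D.eventually_exists_eq a t hlit] with y h1 h2 hyf
  obtain ⟨s, hs, rfl⟩ := h2 (h1 hyf)
  have hs' : ‖D.curve a s - D.curve a t - (s - t) • v‖ ≤ c * ‖s - t‖ := hs
  set w := D.curve a s - D.curve a t with hw
  have horth : inner ℝ (rotLeft v) w = inner ℝ (rotLeft v) (w - (s - t) • v) := by
    simp only [Plane.inner_eq, rotLeft_zero, rotLeft_one, PiLp.sub_apply, PiLp.smul_apply,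
      smul_eq_mul]
    ring
  have e1 : |inner ℝ (rotLeft v) w| ≤ ‖v‖ * (c * ‖s - t‖) := by
    rw [horth]
    refine (abs_real_inner_le_norm _ _).trans ?_
    rw [norm_rotLeft]
    gcongr
  have e2 : ‖s - t‖ * ‖v‖ ≤ ‖w‖ + c * ‖s - t‖ := by
    rw [← norm_smul]
    have := norm_sub_norm_le ((s - t) • v) w
    rw [norm_sub_rev ((s - t) • v) w] at this
    linarith
  have e3 : c * ‖s - t‖ ≤ ‖v‖ / 2 * ‖s - t‖ := by
    gcongr; exact min_le_left _ _
  have e4 : ‖v‖ * (c * ‖s - t‖) ≤ ‖v‖ * (η / 2 * ‖s - t‖) := by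
    gcongr; exact min_le_right _ _
  calc _ ≤ η * (‖s - t‖ * ‖v‖ / 2) := by linarith
    _ ≤ η * ‖w‖ := by gcongr; linarith

/-- The path `G` leaves the curve on the side of `rotLeft v`, so it stays on the same side of the
boundary as the normal segment, whose position relative to `S` is given by `LiesToLeft`. Before time
`r` the argument applies to the reversed path and `-rotLeft v`. -/
lemma eventually_crossing_of_pos (a : D.ι ⊕ D.κ) {t : ℝ} {v : Plane}
    (hv : HasDerivAt (D.curve a) v t) {G : ℝ → Plane} {d : Plane} {r : ℝ} (hG : HasDerivAt G d r)
    (hGr : G r = D.curve a t) (hpos : 0 < inner ℝ (rotLeft v) d) :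
    (∀ᶠ x in 𝓝[>] r, G x ∉ frontier S ∧ G x ∈ S) ∧
      ∀ᶠ x in 𝓝[<] r, G x ∉ frontier S ∧ G x ∉ S := by
  have hv0 : v ≠ 0 := by
    rintro rfl
    simp [Plane.inner_eq] at hpos
  have hleft := D.left a t v hv hv0
  constructor
  · have hF : HasDerivAt (fun ε : ℝ => G (r + ε)) d 0 := by
      apply HasDerivAt.comp_const_add
      simpa using hG
    have h := eventually_mem_iff_of_tangent_frontier
      (fun η hη => D.eventually_tangent a hv hv0 hη) hF.hasDerivWithinAt (by simp [hGr]) hpos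
    have h' : ∀ᶠ ε in 𝓝[>] (0 : ℝ), G (r + ε) ∉ frontier S ∧ G (r + ε) ∈ S := by
      filter_upwards [h, hleft] with ε h1 h2
      exact ⟨h1.1, h1.2.2 h2.1⟩
    have hm : Tendsto (fun x => x - r) (𝓝[>] r) (𝓝[>] 0) := by
      refine tendsto_nhdsWithin_iff.2 ⟨?_, ?_⟩
      · have : Tendsto (fun x => x - r) (𝓝 r) (𝓝 (r - r)) := (continuous_sub_right r).tendsto r
        rw [sub_self] at this
        exact this.mono_left nhdsWithin_le_nhds
      · filter_upwards [self_mem_nhdsWithin] with x hx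
        exact sub_pos.2 (mem_Ioi.1 hx)
    filter_upwards [hm.eventually h'] with x hx
    simpa using hx
  · have hF : HasDerivAt (fun ε : ℝ => G (r - ε)) (-d) 0 := by
      have h1 : HasDerivAt G d (r - 0) := by simpa using hG
      simpa using h1.comp_const_sub r 0
    have h := eventually_mem_iff_of_tangent_frontier (n := -rotLeft v)
      (fun η hη => by simpa using D.eventually_tangent a hv hv0 hη) hF.hasDerivWithinAt
      (by simp [hGr]) (by simpa using hpos)
    have h' : ∀ᶠ ε in 𝓝[>] (0 : ℝ), G (r - ε) ∉ frontier S ∧ G (r - ε) ∉ S := by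
      filter_upwards [h, hleft] with ε h1 h2
      refine ⟨h1.1, fun h3 => h2.2 ?_⟩
      have := h1.2.1 h3
      rwa [smul_neg, ← sub_eq_add_neg] at this
    have hm : Tendsto (fun x => r - x) (𝓝[<] r) (𝓝[>] 0) := by
      refine tendsto_nhdsWithin_iff.2 ⟨?_, ?_⟩
      · have : Tendsto (fun x => r - x) (𝓝 r) (𝓝 (r - r)) := (continuous_sub_left r).tendsto r
        rw [sub_self] at this
        exact this.mono_left nhdsWithin_le_nhds
      · filter_upwards [self_mem_nhdsWithin] with x hx
        exact sub_pos.2 (mem_Iio.1 hx)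
    filter_upwards [hm.eventually h'] with x hx
    simpa using hx

lemma eventually_crossing_of_neg (a : D.ι ⊕ D.κ) {t : ℝ} {v : Plane}
    (hv : HasDerivAt (D.curve a) v t) {G : ℝ → Plane} {d : Plane} {r : ℝ} (hG : HasDerivAt G d r)
    (hGr : G r = D.curve a t) (hneg : inner ℝ (rotLeft v) d < 0) :
    (∀ᶠ x in 𝓝[>] r, G x ∉ frontier S ∧ G x ∉ S) ∧
      ∀ᶠ x in 𝓝[<] r, G x ∉ frontier S ∧ G x ∈ S := by
  have hG' : HasDerivAt (fun x => G (-x)) (-d) (-r) := by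
    have : HasDerivAt G d (- -r) := by simpa using hG
    have h := this.scomp (-r) (hasDerivAt_neg (-r))
    rw [neg_one_smul] at h
    exact h
  obtain ⟨h1, h2⟩ := D.eventually_crossing_of_pos a hv hG' (by simpa using hGr)
    (by simpa using hneg)
  constructor
  · have hm : Tendsto (fun x : ℝ => -x) (𝓝[>] r) (𝓝[<] (-r)) := tendsto_neg_nhdsGT
    filter_upwards [hm.eventually h2] with x hx
    simpa using hx
  · have hm : Tendsto (fun x : ℝ => -x) (𝓝[<] r) (𝓝[>] (-r)) := tendsto_neg_nhdsLT
    filter_upwards [hm.eventually h1] with x hx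
    simpa using hx

end BoundaryCurves

/-! ### Crossings of boundary curves with a graph -/

lemma mem_frameGraph_iff {e : Plane} (he : ‖e‖ = 1) {g : ℝ → ℝ} {x : Plane} :
    x ∈ frameGraph e g ↔ framePoint e (frameX e x) (g (frameX e x)) = x := by
  constructor
  · intro h
    have h' : frameY e x = g (frameX e x) := h
    rw [← h', framePoint_frame he]
  · intro h
    rw [← h]
    exact framePoint_mem_frameGraph he g _

lemma hasDerivAt_framePoint_graph (e : Plane) {g : ℝ → ℝ} {r m : ℝ} (hg : HasDerivAt g m r) :
    HasDerivAt (fun x => framePoint e x (g x)) (framePoint e 1 m) r := by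
  unfold framePoint
  exact ((hasDerivAt_id r).smul_const e).add (hg.smul_const (rotLeft e))

lemma hasDerivAt_plane_apply {γ : ℝ → Plane} {v : Plane} {t : ℝ} (h : HasDerivAt γ v t)
    (i : Fin 2) : HasDerivAt (fun t => γ t i) (v i) t :=
  (EuclideanSpace.proj i : Plane →L[ℝ] ℝ).hasFDerivAt.comp_hasDerivAt t h

lemma hasDerivAt_frameX (e : Plane) {γ : ℝ → Plane} {v : Plane} {t : ℝ} (h : HasDerivAt γ v t) :
    HasDerivAt (fun t => frameX e (γ t)) (frameX e v) t := by
  have h' := hasDerivAt_plane_apply h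
  exact ((h' 0).const_mul (e 0)).add ((h' 1).const_mul (e 1))

lemma hasDerivAt_frameY (e : Plane) {γ : ℝ → Plane} {v : Plane} {t : ℝ} (h : HasDerivAt γ v t) :
    HasDerivAt (fun t => frameY e (γ t)) (frameY e v) t := by
  have h' := hasDerivAt_plane_apply h
  exact ((h' 1).const_mul (e 0)).sub ((h' 0).const_mul (e 1))

/-- This fixes the sign of the count: where a boundary curve rises through the graph, the graph read
from left to right passes from the left of the curve to its right, that is, out of the set. -/
lemma inner_rotLeft_framePoint (e v : Plane) (m : ℝ) :
    inner ℝ (rotLeft v) (framePoint e 1 m) = -(frameY e v - m * frameX e v) := by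
  simp [Plane.inner_eq, frameX, frameY]; ring

/-- The height of `γ t` over the graph of `g`. -/
def heightAlong (e : Plane) (g : ℝ → ℝ) (γ : ℝ → Plane) (t : ℝ) : ℝ :=
  frameY e (γ t) - g (frameX e (γ t))

lemma heightAlong_eq_zero_iff {e : Plane} {g : ℝ → ℝ} {γ : ℝ → Plane} {t : ℝ} :
    heightAlong e g γ t = 0 ↔ γ t ∈ frameGraph e g := by
  simp [heightAlong, frameGraph, sub_eq_zero]

lemma hasDerivAt_heightAlong (e : Plane) {g : ℝ → ℝ} (hg : Differentiable ℝ g) {γ : ℝ → Plane}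
    {v : Plane} {t : ℝ} (h : HasDerivAt γ v t) :
    HasDerivAt (heightAlong e g γ)
      (frameY e v - deriv g (frameX e (γ t)) * frameX e v) t := by
  exact (hasDerivAt_frameY e h).sub ((hg _).hasDerivAt.comp t (hasDerivAt_frameX e h))

lemma continuous_heightAlong (e : Plane) {g : ℝ → ℝ} (hg : Continuous g) {γ : ℝ → Plane}
    (hγ : Continuous γ) : Continuous (heightAlong e g γ) :=
  ((continuous_frameY e).comp hγ).sub (hg.comp ((continuous_frameX e).comp hγ))

namespace BoundaryCurves

variable {S : Set Plane} (D : BoundaryCurves S)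

/-- All boundary curves meet the graph of `g` in regular points, and transversally. -/
def CrossesTransversally (e : Plane) (g : ℝ → ℝ) : Prop :=
  ∀ a t, D.curve a t ∈ frameGraph e g →
    DifferentiableAt ℝ (D.curve a) t ∧ deriv (heightAlong e g (D.curve a)) t ≠ 0

/-- Almost every vertical translate of a graph is crossed transversally. -/
lemma exists_crossesTransversally (e : Plane) {g : ℝ → ℝ} (hg : Differentiable ℝ g) :
    ∃ s ∈ Icc (0 : ℝ) 1, D.CrossesTransversally e (fun r => g r + s) := by
  have := D.countable_index
  choose B hBc hB using fun a => (D.piecewiseRegular_curve a).exists_countable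
  -- Shifts for which the graph meets an irregular point of some curve, or meets a curve
  -- tangentially. Both kinds are null for each curve, and there are countably many curves.
  set bad : Set ℝ := ⋃ a, (heightAlong e g (D.curve a) '' B a ∪
    heightAlong e g (D.curve a) '' {t | DifferentiableAt ℝ (heightAlong e g (D.curve a)) t ∧
      deriv (heightAlong e g (D.curve a)) t = 0}) with hbad
  have hnull : MeasureTheory.volume bad = 0 := by
    rw [hbad, MeasureTheory.measure_iUnion_null_iff]
    intro a
    exact MeasureTheory.measure_union_null
      (((hBc a).image _).measure_zero _) (volume_critical_values_eq_zero _)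
  have hex : ∃ s ∈ Icc (0 : ℝ) 1, s ∉ bad := by
    by_contra! hcon
    have := MeasureTheory.measure_mono_null (show Icc (0 : ℝ) 1 ⊆ bad from hcon) hnull
    simp at this
  obtain ⟨s, hs, hsb⟩ := hex
  refine ⟨s, hs, fun a t hat => ?_⟩
  have hval : heightAlong e g (D.curve a) t = s := by
    have : frameY e (D.curve a t) = g (frameX e (D.curve a t)) + s := hat
    simp [heightAlong, this]
  have hnot : t ∉ B a := fun ht => hsb (mem_iUnion.2 ⟨a, Or.inl ⟨t, ht, hval⟩⟩)
  have hd := (hB a t hnot).1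
  have hhd := hasDerivAt_heightAlong e hg hd.hasDerivAt
  refine ⟨hd, ?_⟩
  have heq : heightAlong e (fun r => g r + s) (D.curve a) =
      fun t => heightAlong e g (D.curve a) t - s := by
    funext t; simp only [heightAlong]; ring
  rw [heq, deriv_sub_const]
  intro h0
  exact hsb (mem_iUnion.2 ⟨a, Or.inr ⟨t, ⟨hhd.differentiableAt, h0⟩, hval⟩⟩)

open Classical in
/-- The jump of the indicator of `S` along the graph of `g`, from right to left. -/
noncomputable def graphJump (S : Set Plane) (e : Plane) (g : ℝ → ℝ) (r : ℝ) : ℤ :=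
  (if ∀ᶠ x in 𝓝[<] r, framePoint e x (g x) ∈ S then 1 else 0) -
    (if ∀ᶠ x in 𝓝[>] r, framePoint e x (g x) ∈ S then 1 else 0)

variable {D} {e : Plane} {g : ℝ → ℝ}

-- Each crossing is isolated, the indicator of `S` has one-sided limits there along the graph, and
-- its jump equals the sign of the crossing seen from the curve. This equality links the two ways of
-- counting.
open Classical in
lemma CrossesTransversally.spec (hD : D.CrossesTransversally e g) (hg : Differentiable ℝ g)
    {a : D.ι ⊕ D.κ} {t r : ℝ} (he : ‖e‖ = 1) (hr : D.curve a t = framePoint e r (g r)) :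
    (∀ᶠ x in 𝓝[≠] r, framePoint e x (g x) ∉ frontier S) ∧
    (∀ᶠ x in 𝓝[>] r, (if framePoint e x (g x) ∈ S then (1 : ℤ) else 0) =
      if ∀ᶠ x in 𝓝[>] r, framePoint e x (g x) ∈ S then 1 else 0) ∧
    (∀ᶠ x in 𝓝[<] r, (if framePoint e x (g x) ∈ S then (1 : ℤ) else 0) =
      if ∀ᶠ x in 𝓝[<] r, framePoint e x (g x) ∈ S then 1 else 0) ∧
    graphJump S e g r = if 0 < deriv (heightAlong e g (D.curve a)) t then 1 else -1 := by
  have hmem : D.curve a t ∈ frameGraph e g := hr ▸ framePoint_mem_frameGraph he g r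
  obtain ⟨hd, hne⟩ := hD a t hmem
  have hX : frameX e (D.curve a t) = r := by rw [hr, frameX_framePoint he]
  have hder := (hasDerivAt_heightAlong e hg hd.hasDerivAt).deriv
  rw [hX] at hder
  have hG := hasDerivAt_framePoint_graph e (hg r).hasDerivAt
  have hinner := inner_rotLeft_framePoint e (deriv (D.curve a) t) (deriv g r)
  rw [← hder] at hinner
  rcases hne.lt_or_gt with hlt | hgt
  · obtain ⟨h1, h2⟩ := D.eventually_crossing_of_pos a hd.hasDerivAt hG hr.symm
      (by rw [hinner]; linarith)
    have c1 : ∀ᶠ x in 𝓝[>] r, framePoint e x (g x) ∈ S := h1.mono fun x hx => hx.2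
    have c2 : ¬ ∀ᶠ x in 𝓝[<] r, framePoint e x (g x) ∈ S := fun h => by
      obtain ⟨x, hx1, hx2⟩ := (h.and h2).exists
      exact hx2.2 hx1
    refine ⟨?_, ?_, ?_, ?_⟩
    · rw [← Iio_union_Ioi, nhdsWithin_union, eventually_sup]
      exact ⟨h2.mono fun x hx => hx.1, h1.mono fun x hx => hx.1⟩
    · rw [if_pos c1]
      exact h1.mono fun x hx => if_pos hx.2
    · rw [if_neg c2]
      exact h2.mono fun x hx => if_neg hx.2
    · rw [graphJump, if_neg c2, if_pos c1, if_neg hlt.not_gt]; rfl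
  · obtain ⟨h1, h2⟩ := D.eventually_crossing_of_neg a hd.hasDerivAt hG hr.symm
      (by rw [hinner]; linarith)
    have c1 : ∀ᶠ x in 𝓝[<] r, framePoint e x (g x) ∈ S := h2.mono fun x hx => hx.2
    have c2 : ¬ ∀ᶠ x in 𝓝[>] r, framePoint e x (g x) ∈ S := fun h => by
      obtain ⟨x, hx1, hx2⟩ := (h.and h1).exists
      exact hx2.2 hx1
    refine ⟨?_, ?_, ?_, ?_⟩
    · rw [← Iio_union_Ioi, nhdsWithin_union, eventually_sup]
      exact ⟨h2.mono fun x hx => hx.1, h1.mono fun x hx => hx.1⟩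
    · rw [if_neg c2]
      exact h1.mono fun x hx => if_neg hx.2
    · rw [if_pos c1]
      exact h2.mono fun x hx => if_pos hx.2
    · rw [graphJump, if_pos c1, if_neg c2, if_pos hgt]; rfl

/-- If all crossings of a graph with the boundary of `S` lie over a bounded interval, they are
finitely many. -/
lemma CrossesTransversally.finite (hD : D.CrossesTransversally e g) (hg : Differentiable ℝ g)
    (he : ‖e‖ = 1) {R : ℝ} (hR : ∀ r, framePoint e r (g r) ∈ frontier S → |r| < R) :
    {r | framePoint e r (g r) ∈ frontier S}.Finite := by
  have hcont : Continuous fun r => framePoint e r (g r) :=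
    (continuous_framePoint e).comp (continuous_id.prodMk hg.continuous)
  have hK : IsCompact {r | framePoint e r (g r) ∈ frontier S} := by
    apply isCompact_Icc.of_isClosed_subset (isClosed_frontier.preimage hcont)
    intro r hr
    exact abs_le.1 (hR r hr).le
  by_contra hinf
  obtain ⟨r, hr, hacc⟩ := Set.Infinite.exists_accPt_of_subset_isCompact hinf hK subset_rfl
  obtain ⟨a, t, hat⟩ := D.mem_frontier_iff.1 hr
  rw [accPt_iff_frequently_nhdsNE] at hacc
  exact hacc ((hD.spec hg he hat).1.mono fun x hx hm => hx hm)

/-- Along a graph, the jumps of the indicator of `S` add up to its total change. -/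
lemma CrossesTransversally.sum_graphJump (hD : D.CrossesTransversally e g)
    (hg : Differentiable ℝ g) (he : ‖e‖ = 1) {R : ℝ} (hR0 : 0 ≤ R)
    (hR : ∀ r, framePoint e r (g r) ∈ frontier S → |r| < R)
    (hpos : framePoint e R (g R) ∈ S) (hneg : framePoint e (-R) (g (-R)) ∉ S)
    {Z : Finset ℝ} (hZ : ∀ r, r ∈ Z ↔ framePoint e r (g r) ∈ frontier S) :
    ∑ r ∈ Z, graphJump S e g r = -1 := by
  classical
  have hcont : Continuous fun r => framePoint e r (g r) :=
    (continuous_framePoint e).comp (continuous_id.prodMk hg.continuous)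
  have hex : ∀ r ∈ Z, ∃ a t, D.curve a t = framePoint e r (g r) := fun r hr =>
    D.mem_frontier_iff.1 ((hZ r).1 hr)
  have h := jump_sum (φ := fun r => if framePoint e r (g r) ∈ S then (1 : ℤ) else 0)
    (A := fun r => if ∀ᶠ x in 𝓝[>] r, framePoint e x (g x) ∈ S then 1 else 0)
    (B := fun r => if ∀ᶠ x in 𝓝[<] r, framePoint e x (g x) ∈ S then 1 else 0)
    (a := -R) (b := R) (Z := Z) (by linarith)
    (fun r hr => abs_lt.1 (hR r ((hZ r).1 hr))) ?_ ?_ ?_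
  · rw [if_pos hpos, if_neg hneg] at h
    simp only [graphJump]
    rw [Finset.sum_sub_distrib] at h ⊢
    linarith
  · intro t _ ht
    have := hcont.continuousAt.eventually
      (eventually_mem_iff_of_notMem_frontier fun h => ht ((hZ t).2 h))
    exact this.mono fun x hx => by simp only [hx]
  · intro r hr
    obtain ⟨a, t, hat⟩ := hex r hr
    exact (hD.spec hg he hat).2.1
  · intro r hr
    obtain ⟨a, t, hat⟩ := hex r hr
    exact (hD.spec hg he hat).2.2.1

/-- Along an arc of a boundary curve which passes exactly once through each crossing of that curve
with the graph, the jumps add up to the total change of the indicator of the epigraph. -/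
lemma CrossesTransversally.sum_graphJump_curve (hD : D.CrossesTransversally e g)
    (hg : Differentiable ℝ g) (he : ‖e‖ = 1) (a : D.ι ⊕ D.κ) {α β : ℝ} (hαβ : α ≤ β)
    (hα : D.curve a α ∉ frameGraph e g) (hβ : D.curve a β ∉ frameGraph e g)
    (hinj : InjOn (D.curve a) (Ioo α β))
    (hsurj : ∀ t, D.curve a t ∈ frameGraph e g → ∃ s ∈ Ioo α β, D.curve a s = D.curve a t)
    {Z : Finset ℝ} (hZ : ∀ r, r ∈ Z ↔ framePoint e r (g r) ∈ range (D.curve a)) :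
    ∑ r ∈ Z, graphJump S e g r =
      (if 0 ≤ heightAlong e g (D.curve a) β then 1 else 0) -
        (if 0 ≤ heightAlong e g (D.curve a) α then 1 else 0) := by
  set h := heightAlong e g (D.curve a) with hh
  have hcont : Continuous h := continuous_heightAlong e hg.continuous (D.continuous_curve a)
  have hreg : ∀ t, h t = 0 → DifferentiableAt ℝ h t ∧ deriv h t ≠ 0 := fun t ht => by
    obtain ⟨h1, h2⟩ := hD a t (heightAlong_eq_zero_iff.1 ht)
    exact ⟨(hasDerivAt_heightAlong e hg h1.hasDerivAt).differentiableAt, h2⟩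
  have hfin : {t | t ∈ Ioo α β ∧ h t = 0}.Finite :=
    (finite_zeros_Icc hcont hreg α β).subset fun t ht => ⟨Ioo_subset_Icc_self ht.1, ht.2⟩
  have hmem : ∀ t, t ∈ hfin.toFinset ↔ t ∈ Ioo α β ∧ h t = 0 := by simp
  rw [sign_change_eq_sum hcont hαβ hmem (fun h0 => hα (heightAlong_eq_zero_iff.1 h0))
    (fun h0 => hβ (heightAlong_eq_zero_iff.1 h0)) fun t ht => hreg t ((hmem t).1 ht).2]
  have hback : ∀ t, h t = 0 →
      D.curve a t = framePoint e (frameX e (D.curve a t)) (g (frameX e (D.curve a t))) :=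
    fun t ht => ((mem_frameGraph_iff he).1 (heightAlong_eq_zero_iff.1 ht)).symm
  symm
  -- A point of the graph is determined by its abscissa, so zeros of the height on the arc
  -- correspond bijectively to abscissas of crossings with this curve.
  refine Finset.sum_nbij (fun t => frameX e (D.curve a t)) ?_ ?_ ?_ ?_
  · intro t ht
    rw [hZ, ← hback t ((hmem t).1 ht).2]
    exact mem_range_self t
  · intro t ht s hs hts
    have ht' := (hmem t).1 ht
    have hs' := (hmem s).1 hs
    refine hinj ht'.1 hs'.1 ?_
    have hts' : frameX e (D.curve a t) = frameX e (D.curve a s) := hts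
    rw [hback t ht'.2, hback s hs'.2, hts']
  · intro r hr
    obtain ⟨t, ht⟩ := (hZ r).1 hr
    have htg : D.curve a t ∈ frameGraph e g := ht ▸ framePoint_mem_frameGraph he g r
    obtain ⟨s, hs, hst⟩ := hsurj t htg
    refine ⟨s, (hmem s).2 ⟨hs, heightAlong_eq_zero_iff.2 (hst ▸ htg)⟩, ?_⟩
    simp only [hst, ht, frameX_framePoint he]
  · intro t ht
    exact ((hD.spec hg he (hback t ((hmem t).1 ht).2)).2.2.2).symm

/-- A closed curve crosses the graph as often upwards as downwards. -/
lemma CrossesTransversally.sum_graphJump_loop (hD : D.CrossesTransversally e g)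
    (hg : Differentiable ℝ g) (he : ‖e‖ = 1) (k : D.κ) {Z : Finset ℝ}
    (hZ : ∀ r, r ∈ Z ↔ framePoint e r (g r) ∈ range (D.curve (Sum.inr k))) :
    ∑ r ∈ Z, graphJump S e g r = 0 := by
  obtain ⟨T, hT, hp, hinj⟩ := (D.loop_closed k).periodic
  have hp' : Function.Periodic (D.curve (Sum.inr k)) T := hp
  have hcont : Continuous (heightAlong e g (D.curve (Sum.inr k))) :=
    continuous_heightAlong e hg.continuous (D.continuous_curve _)
  have hfin := finite_zeros_Icc hcont (fun t ht => by
    obtain ⟨h1, h2⟩ := hD _ t (heightAlong_eq_zero_iff.1 ht)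
    exact ⟨(hasDerivAt_heightAlong e hg h1.hasDerivAt).differentiableAt, h2⟩) 0 1
  -- The period is started at a point off the graph, so that no crossing falls on an endpoint; this
  -- is possible because crossings are isolated.
  obtain ⟨α, hα1, hα2⟩ := (Icc_infinite (zero_lt_one' ℝ)).exists_notMem_finite hfin
  have hα : D.curve (Sum.inr k) α ∉ frameGraph e g := fun h =>
    hα2 ⟨hα1, heightAlong_eq_zero_iff.2 h⟩
  have hper : D.curve (Sum.inr k) (α + T) = D.curve (Sum.inr k) α := hp' α
  rw [hD.sum_graphJump_curve hg he (Sum.inr k) (α := α) (β := α + T) (by linarith) hα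
    (hper ▸ hα) ?_ ?_ hZ]
  · simp only [heightAlong, hper]
    exact sub_self _
  · intro s hs t ht hst
    obtain ⟨n, rfl⟩ := eq_add_int_mul_of_periodic hT hp hinj hst
    have h1 : (n : ℝ) < 1 := by nlinarith [hs.2, ht.1]
    have h2 : (-1 : ℝ) < n := by nlinarith [hs.1, ht.2]
    have h1' : n < 1 := by exact_mod_cast h1
    have h2' : -1 < n := by exact_mod_cast h2
    have : n = 0 := by omega
    simp [this]
  · intro t ht
    have hs : D.curve (Sum.inr k) (toIcoMod hT α t) = D.curve (Sum.inr k) t := by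
      rw [toIcoMod]
      simpa using hp'.sub_zsmul_eq (x := t) (toIcoDiv hT α t)
    have hm := toIcoMod_mem_Ico hT α t
    refine ⟨_, ⟨lt_of_le_of_ne hm.1 fun heq => hα ?_, hm.2⟩, hs⟩
    rw [heq, hs]
    exact ht

/-- If the graph of `g` runs from the complement of `S` into `S`, then the proper boundary curves
of `S` cross it, algebraically, once from above to below. -/
theorem CrossesTransversally.finsum_eq (hD : D.CrossesTransversally e g)
    (hg : Differentiable ℝ g) (he : ‖e‖ = 1) {R : ℝ} (hR0 : 0 ≤ R)
    (hR : ∀ r, framePoint e r (g r) ∈ frontier S → |r| < R)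
    (hpos : framePoint e R (g R) ∈ S) (hneg : framePoint e (-R) (g (-R)) ∉ S)
    {c : D.ι → ℤ}
    (hc : ∀ i, ∃ b, 0 ≤ b ∧ (∀ t, b ≤ |t| → D.line i t ∉ frameGraph e g) ∧
      c i = (if 0 ≤ heightAlong e g (D.line i) b then 1 else 0) -
        (if 0 ≤ heightAlong e g (D.line i) (-b) then 1 else 0)) :
    ∑ᶠ i, c i = -1 := by
  classical
  have hfin := hD.finite hg he hR
  set Z := hfin.toFinset with hZdef
  have hZ : ∀ r, r ∈ Z ↔ framePoint e r (g r) ∈ frontier S := by simp [hZdef]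
  have hidx : ∀ r : ℝ, r ∈ Z → ∃ a, framePoint e r (g r) ∈ range (D.curve a) := fun r hr => by
    obtain ⟨a, t, hat⟩ := D.mem_frontier_iff.1 ((hZ r).1 hr)
    exact ⟨a, t, hat⟩
  set u : Finset (D.ι ⊕ D.κ) := Z.attach.image fun r => (hidx r.1 r.2).choose with hu
  have hmemu : ∀ r a, framePoint e r (g r) ∈ range (D.curve a) → a ∈ u := by
    rintro r a ⟨t, ht⟩
    have hr : r ∈ Z := (hZ r).2 (ht ▸ D.curve_mem_frontier a t)
    obtain ⟨s, hs⟩ := (hidx r hr).choose_spec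
    rw [hu, Finset.mem_image]
    exact ⟨⟨r, hr⟩, Finset.mem_attach _ _, D.curve_index_unique (hs.trans ht.symm)⟩
  set F : D.ι ⊕ D.κ → ℤ := fun a =>
    ∑ r ∈ Z with framePoint e r (g r) ∈ range (D.curve a), graphJump S e g r with hF
  have hfilter : ∀ a r, r ∈ Z.filter (fun r => framePoint e r (g r) ∈ range (D.curve a)) ↔
      framePoint e r (g r) ∈ range (D.curve a) := by
    intro a r
    rw [Finset.mem_filter, and_iff_right_iff_imp]
    rintro ⟨t, ht⟩
    exact (hZ r).2 (ht ▸ D.curve_mem_frontier a t)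
  have hFr : ∀ k, F (Sum.inr k) = 0 := fun k => hD.sum_graphJump_loop hg he k (hfilter _)
  have hFl : ∀ i, F (Sum.inl i) = c i := by
    intro i
    obtain ⟨b, hb0, hb, hci⟩ := hc i
    rw [hci]
    refine hD.sum_graphJump_curve hg he (Sum.inl i) (α := -b) (β := b) (by linarith)
      (hb _ (by rw [abs_neg]; exact le_abs_self b)) (hb _ (le_abs_self b))
      ((D.line_proper i).injective.injOn) (fun t ht => ⟨t, abs_lt.1 ?_, rfl⟩) (hfilter _)
    by_contra hcon
    exact hb t (not_lt.1 hcon) ht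
  have htotal : ∑ a ∈ u, F a = ∑ r ∈ Z, graphJump S e g r := by
    -- Grouping crossings by curve loses and repeats nothing, since disjointness puts each of them
    -- on exactly one boundary curve.
    simp only [hF, Finset.sum_filter]
    rw [Finset.sum_comm]
    refine Finset.sum_congr rfl fun r hr => ?_
    obtain ⟨a, ha⟩ := hidx r hr
    rw [Finset.sum_eq_single_of_mem a (hmemu r a ha), if_pos ha]
    intro b _ hba
    refine if_neg fun hb => hba ?_
    obtain ⟨t, ht⟩ := ha
    obtain ⟨s, hs⟩ := hb
    exact D.curve_index_unique (hs.trans ht.symm)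
  have hsplit : ∑ a ∈ u, F a = ∑ i ∈ u.toLeft, c i := by
    rw [← Finset.toLeft_disjSum_toRight (u := u), Finset.sum_disjSum]
    simp [hFl, hFr]
  rw [finsum_eq_sum_of_support_subset c (s := u.toLeft), ← hsplit, htotal,
    hD.sum_graphJump hg he hR0 hR hpos hneg hZ]
  intro i hi
  rw [Finset.mem_coe, Finset.mem_toLeft]
  by_contra hcon
  apply hi
  rw [← hFl]
  refine Finset.sum_eq_zero fun r hr => absurd (hmemu r _ ((hfilter _ r).1 hr)) hcon

end BoundaryCurves

/-! ### Transversality -/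

lemma tendsto_norm_cobounded_plane :
    Tendsto (fun x : Plane => ‖x‖) (Bornology.cobounded Plane) atTop :=
  tendsto_norm_cobounded_atTop

/-- A positive lower limit makes the gauge eventually exceed a fixed positive power of `‖x‖`. The
uniqueness proof uses only that the gauge tends to infinity. -/
lemma Transverse.eventually_le_boundaryGauge {S V : Set Plane} (h : Transverse S V) (K : ℝ) :
    ∀ᶠ x in Bornology.cobounded Plane, K ≤ boundaryGauge S V x := by
  obtain ⟨q, hq0, hq⟩ := EReal.lt_iff_exists_real_btwn.1 h
  have hq0' : 0 < q := by exact_mod_cast hq0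
  have h1 := eventually_lt_of_lt_liminf hq
  have hlog := Real.tendsto_log_atTop.comp tendsto_norm_cobounded_plane
  filter_upwards [h1, hlog.eventually_gt_atTop 0, hlog.eventually_ge_atTop (Real.log K / q)]
    with x e1 e2 e3
  simp only [Function.comp_apply] at e2 e3
  have e1' : q < Real.log (boundaryGauge S V x) / Real.log ‖x‖ := by exact_mod_cast e1
  rw [lt_div_iff₀ e2] at e1'
  rw [div_le_iff₀ hq0'] at e3
  have hpos : 0 < boundaryGauge S V x := by
    have h1 := Metric.infDist_nonneg (x := x) (s := frontier S)
    have h2 := Metric.infDist_nonneg (x := x) (s := frontier V)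
    unfold boundaryGauge
    linarith
  rcases le_or_gt K 0 with hK | hK
  · linarith
  · rw [← Real.log_le_log_iff hK hpos]
    nlinarith

lemma transverse_of_eventually_ge {S V : Set Plane} {m β : ℝ} (hm : 0 < m) (hβ : 0 < β)
    (h : ∀ᶠ x in Bornology.cobounded Plane, m * ‖x‖ ^ β ≤ boundaryGauge S V x) :
    Transverse S V := by
  have hlog := Real.tendsto_log_atTop.comp tendsto_norm_cobounded_plane
  have key : ∀ᶠ x in Bornology.cobounded Plane,
      ((β / 2 : ℝ) : EReal) ≤
        ((Real.log (boundaryGauge S V x) / Real.log ‖x‖ : ℝ) : EReal) := by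
    filter_upwards [h, hlog.eventually_gt_atTop 0,
      hlog.eventually_ge_atTop (-Real.log m / (β / 2)),
      tendsto_norm_cobounded_plane.eventually_gt_atTop 0] with x e1 e2 e3 e4
    simp only [Function.comp_apply] at e2 e3
    rw [div_le_iff₀ (by positivity)] at e3
    have hpow : 0 < ‖x‖ ^ β := Real.rpow_pos_of_pos e4 β
    have := Real.log_le_log (by positivity) e1
    rw [Real.log_mul hm.ne' hpow.ne', Real.log_rpow e4] at this
    rw [EReal.coe_le_coe_iff, le_div_iff₀ e2]
    linarith
  refine lt_of_lt_of_le ?_ (le_liminf_of_le (by isBoundedDefault) key)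
  exact_mod_cast (by positivity : 0 < β / 2)

/-- A set whose boundary stays at distance `c |r| ^ β` from the points of a graph is transverse to
the epigraph. -/
lemma transverse_frameEpigraph {S : Set Plane} (hS : (frontier S).Nonempty) {e : Plane}
    (he : ‖e‖ = 1) {f : ℝ → ℝ} (hf : Continuous f) {A B : ℝ} (hfg : ∀ r, |f r| ≤ A * |r| + B)
    {c β R : ℝ} (hc : 0 < c) (hβ : 0 < β) (hβ1 : β ≤ 1)
    (h : ∀ r, R ≤ |r| →
      ∀ z ∈ frontier S, z ∉ Metric.ball (framePoint e r (f r)) (c * |r| ^ β)) :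
    Transverse S (frameEpigraph e f) := by
  wlog hA : 0 ≤ A ∧ 0 ≤ B generalizing A B
  · refine this (A := |A|) (B := |B|) (fun r => (hfg r).trans ?_) ⟨abs_nonneg _, abs_nonneg _⟩
    gcongr <;> exact le_abs_self _
  obtain ⟨hA, hB⟩ := hA
  -- If the graph point `y` nearest to `x` has `‖y‖ ≥ ‖x‖ / 2`, then `‖y‖ ≤ (A + 1) * |r| + B` and
  -- `4 * B ≤ ‖x‖` give `|r| ≥ ‖x‖ / a`, so the hypothesis on discs applies at `y`. Otherwise `x` is
  -- at distance at least `‖x‖ / 2` from the graph.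
  set a := 4 * (A + 1) with ha
  have hapos : 0 < a := by positivity
  have hm : 0 < min (1 / 2) (c * (1 / a) ^ β) := by positivity
  refine transverse_of_eventually_ge hm hβ ?_
  have hn := tendsto_norm_cobounded_plane
  filter_upwards [hn.eventually_ge_atTop 1, hn.eventually_ge_atTop (4 * B),
    hn.eventually_ge_atTop (a * R)] with x e1 e2 e3
  have hΓ : (frontier (frameEpigraph e f)).Nonempty :=
    ⟨framePoint e 0 (f 0), frontier_frameEpigraph he hf ▸ framePoint_mem_frameGraph he f 0⟩
  obtain ⟨z, hz, hzx⟩ := isClosed_frontier.exists_infDist_eq_dist hS x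
  obtain ⟨y, hy, hyx⟩ := isClosed_frontier.exists_infDist_eq_dist hΓ x
  rw [boundaryGauge, hzx, hyx]
  rw [frontier_frameEpigraph he hf] at hy
  have hpow : ‖x‖ ^ β ≤ ‖x‖ := Real.rpow_le_self_of_one_le e1 hβ1
  have hpow0 : 0 ≤ ‖x‖ ^ β := by positivity
  have hdz : 0 ≤ dist x z := dist_nonneg
  have hdy : 0 ≤ dist x y := dist_nonneg
  rcases lt_or_ge ‖y‖ (‖x‖ / 2) with hlt | hge
  · have h1 : ‖x‖ - ‖y‖ ≤ dist x y := by
      rw [dist_eq_norm]; exact norm_sub_norm_le x y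
    have h2 : min (1 / 2) (c * (1 / a) ^ β) * ‖x‖ ^ β ≤ 1 / 2 * ‖x‖ ^ β := by
      gcongr; exact min_le_left _ _
    linarith
  · set r := frameX e y with hr
    have hyr : framePoint e r (f r) = y := (mem_frameGraph_iff he).1 hy
    have hny : ‖y‖ ≤ (A + 1) * |r| + B := by
      have h1 := norm_le_frame he y
      have h2 : frameY e y = f r := hy
      rw [h2] at h1
      linarith [hfg r]
    have hra : ‖x‖ / a ≤ |r| := by
      rw [div_le_iff₀ hapos, ha]
      nlinarith
    have hR : R ≤ |r| := by
      refine le_trans ?_ hra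
      rw [le_div_iff₀ hapos]; linarith
    have hball := h r hR z hz
    rw [hyr, Metric.mem_ball, not_lt] at hball
    have htri : dist z y ≤ dist x z + dist x y := by
      rw [dist_comm x z]; exact dist_triangle z x y
    have h1 : (‖x‖ / a) ^ β ≤ |r| ^ β := by gcongr
    have h2 : (‖x‖ / a) ^ β = (1 / a) ^ β * ‖x‖ ^ β := by
      rw [← Real.mul_rpow (by positivity) (by positivity)]
      congr 1; ring
    have h3 : min (1 / 2) (c * (1 / a) ^ β) * ‖x‖ ^ β ≤ c * (1 / a) ^ β * ‖x‖ ^ β := by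
      gcongr; exact min_le_right _ _
    have h4 : c * ((1 / a) ^ β * ‖x‖ ^ β) ≤ c * |r| ^ β := by
      rw [← h2]; gcongr
    linarith

/-! ### Lattice points -/

lemma exists_mem_integerLattice_dist_le (x : Plane) : ∃ z ∈ integerLattice, dist z x ≤ 1 := by
  refine ⟨!₂[(round (x 0) : ℝ), (round (x 1) : ℝ)], ?_, ?_⟩
  · intro i
    fin_cases i
    · exact ⟨round (x 0), by simp⟩
    · exact ⟨round (x 1), by simp⟩
  · rw [dist_eq_norm]
    apply le_of_sq_le_sq _ zero_le_one
    rw [Plane.norm_sq]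
    have h0 := abs_le.1 (abs_sub_round (x 0))
    have h1 := abs_le.1 (abs_sub_round (x 1))
    simp only [PiLp.sub_apply, Matrix.cons_val_zero, Matrix.cons_val_one]
    nlinarith

lemma eq_of_dist_lt_one {x y : Plane} (hx : x ∈ integerLattice) (hy : y ∈ integerLattice)
    (h : dist x y < 1) : x = y := by
  have key : ∀ i, x i = y i := by
    intro i
    obtain ⟨m, hm⟩ := hx i
    obtain ⟨n, hn⟩ := hy i
    have h1 : |x i - y i| < 1 := by
      refine lt_of_le_of_lt ?_ h
      rw [dist_eq_norm]
      simpa using PiLp.norm_apply_le (x - y) i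
    rw [hm, hn] at h1 ⊢
    have h1' : |(m : ℝ) - (n : ℝ)| < 1 := h1
    have h2 : |m - n| < 1 := by exact_mod_cast h1'
    rw [Int.abs_lt_one_iff, sub_eq_zero] at h2
    rw [h2]
  exact Plane.ext (key 0) (key 1)

lemma countable_integerLattice : integerLattice.Countable := by
  have : integerLattice ⊆ range fun p : ℤ × ℤ => (!₂[(p.1 : ℝ), (p.2 : ℝ)] : Plane) := by
    intro x hx
    obtain ⟨m, hm⟩ := hx 0
    obtain ⟨n, hn⟩ := hx 1
    exact ⟨(m, n), Plane.ext (by simp [hm]) (by simp [hn])⟩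
  exact (countable_range _).mono this

/-! ### Uniqueness of the intersection number -/

lemma indicatorInt_of_mem {V : Set Plane} {x : Plane} (h : x ∈ V) : indicatorInt V x = 1 :=
  indicator_of_mem h _

lemma indicatorInt_of_notMem {V : Set Plane} {x : Plane} (h : x ∉ V) : indicatorInt V x = 0 :=
  indicator_of_notMem h _

/-- Near the ends of a graph, a set that is transverse to its epigraph is determined by its lattice
points. -/
lemma Transverse.exists_strip {U W : Set Plane} {e : Plane} (he : ‖e‖ = 1) {f : ℝ → ℝ}
    (hf : Continuous f) {A B : ℝ} (hfg : ∀ r, |f r| ≤ A * |r| + B) {R : ℝ}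
    (hpos : ∀ r, R ≤ r → Metric.ball (framePoint e r (f r)) 2 ⊆ U)
    (hneg : ∀ r, r ≤ -R → Metric.ball (framePoint e r (f r)) 2 ⊆ Uᶜ)
    (hW : W ∩ integerLattice = U ∩ integerLattice) (hT : Transverse W (frameEpigraph e f))
    {K : ℝ} (hK : 0 ≤ K) :
    ∃ R₁, ∀ x, R₁ ≤ ‖x‖ → |frameY e x - f (frameX e x)| ≤ K →
      x ∉ frontier W ∧ (0 < frameX e x → x ∈ W) ∧ (frameX e x < 0 → x ∉ W) := by
  obtain ⟨R₂, -, hR₂⟩ := hasBasis_cobounded_norm.eventually_iff.1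
    -- Since `x` is within `K` of the graph, this leaves a ball of radius `K + 2` about `x` free of
    -- `frontier W`. It contains a lattice point within 1 of the graph point `y`, and that point
    -- decides whether `x ∈ W`.
    (hT.eventually_le_boundaryGauge (1 + (K + 2) + K))
  -- In the strip, the ordinate is bounded linearly by the abscissa, so the second bound forces `R ≤
  -- |frameX e x|`.
  refine ⟨max R₂ ((|A| + 1) * |R| + |B| + K + 1), fun x hx hxK => ?_⟩
  have hg := hR₂ (show R₂ ≤ ‖x‖ from (le_max_left _ _).trans hx)
  have hxn : (|A| + 1) * |R| + |B| + K + 1 ≤ ‖x‖ := (le_max_right _ _).trans hx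
  set y := framePoint e (frameX e x) (f (frameX e x)) with hy
  have hxy : dist x y ≤ K := by
    rw [hy]
    nth_rewrite 1 [← framePoint_frame he x]
    rw [dist_framePoint_right he]
    exact hxK
  have hyV : y ∈ frontier (frameEpigraph e f) :=
    frontier_frameEpigraph he hf ▸ framePoint_mem_frameGraph he f _
  have hinf := (Metric.infDist_le_dist_of_mem hyV).trans hxy
  rw [boundaryGauge] at hg
  have hball : ∀ w ∈ Metric.ball x (K + 2), w ∉ frontier W := by
    intro w hw hwf
    have := Metric.infDist_le_dist_of_mem (x := x) hwf
    rw [Metric.mem_ball'] at hw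
    linarith
  obtain ⟨z, hz, hzy⟩ := exists_mem_integerLattice_dist_le y
  have hzball : z ∈ Metric.ball y 2 := by
    rw [Metric.mem_ball]; linarith
  have hzx : z ∈ Metric.ball x (K + 2) := by
    rw [Metric.mem_ball]
    have := dist_triangle z y x
    rw [dist_comm y x] at this
    linarith
  have hxx : x ∈ Metric.ball x (K + 2) := Metric.mem_ball_self (by linarith)
  have hiff : z ∈ W ↔ x ∈ W :=
    (convex_ball x (K + 2)).isPreconnected.mem_iff_of_disjoint_frontier hball hzx hxx
  have hzW : z ∈ W ↔ z ∈ U := by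
    have := Set.ext_iff.1 hW z
    simpa [hz] using this
  have hX : R ≤ |frameX e x| := by
    have h1 := norm_le_frame he x
    have h2 := hfg (frameX e x)
    have h3 : |frameY e x| ≤ |f (frameX e x)| + K := by
      have := abs_sub_abs_le_abs_sub (frameY e x) (f (frameX e x))
      linarith
    have h4 : A * |frameX e x| ≤ |A| * |frameX e x| := by
      gcongr; exact le_abs_self A
    have h5 := le_abs_self B
    have h6 := le_abs_self R
    by_contra! hlt
    have h7 : (|A| + 1) * |frameX e x| ≤ (|A| + 1) * |R| :=
      mul_le_mul_of_nonneg_left (by linarith) (by positivity)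
    linarith
  refine ⟨hball x hxx, fun h => ?_, fun h => ?_⟩
  · rw [abs_of_pos h] at hX
    exact hiff.1 (hzW.2 (hpos _ hX hzball))
  · rw [abs_of_neg h] at hX
    exact fun hxW => hneg _ (by linarith) hzball (hzW.1 (hiff.2 hxW))

lemma abs_mul_sqrt_le (k r : ℝ) : |k * √(1 + r ^ 2)| ≤ |k| * |r| + |k| := by
  rw [abs_mul, abs_of_nonneg (Real.sqrt_nonneg _)]
  have : √(1 + r ^ 2) ≤ |r| + 1 := by
    rw [Real.sqrt_le_left (by positivity)]
    nlinarith [sq_abs r, abs_nonneg r]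
  nlinarith [abs_nonneg k]

/-- Inside a strip of half-width `C + 1` about the graph of `f`, the boundary of an admissible `W`
is bounded. The ends of its proper curves therefore lie outside the strip, where the epigraphs of
`f` and of the smooth `g` agree, and the crossing count for `g` yields the number defined with `f`.
-/
theorem HasIntersectionNumber.eq_neg_one {U : Set Plane} {e : Plane} (he : ‖e‖ = 1) {f : ℝ → ℝ}
    (hf : Continuous f) {k C : ℝ} (hfg : ∀ r, |f r - k * √(1 + r ^ 2)| ≤ C) {R : ℝ}
    (hpos : ∀ r, R ≤ r → Metric.ball (framePoint e r (f r)) 2 ⊆ U)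
    (hneg : ∀ r, r ≤ -R → Metric.ball (framePoint e r (f r)) 2 ⊆ Uᶜ) {n : ℤ}
    (h : HasIntersectionNumber U (frameEpigraph e f) n) : n = -1 := by
  obtain ⟨W, D, c, hW, hT, hlim, -, rfl⟩ := h
  have hC : 0 ≤ C := (abs_nonneg _).trans (hfg 0)
  have hlin : ∀ r, |f r| ≤ |k| * |r| + (|k| + C) := fun r => by
    have h1 := abs_mul_sqrt_le k r
    have h2 := abs_sub_abs_le_abs_sub (f r) (k * √(1 + r ^ 2))
    linarith [hfg r]
  obtain ⟨R₁, hR₁⟩ := hT.exists_strip he hf hlin hpos hneg hW (K := C + 1) (by linarith)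
  have hg₀ : Differentiable ℝ fun r : ℝ => k * √(1 + r ^ 2) := by
    intro r
    have : DifferentiableAt ℝ (fun r : ℝ => 1 + r ^ 2) r := by fun_prop
    exact (this.sqrt (by positivity)).const_mul k
  -- The function `f` may have corners, so the regular shift is applied to `k * √(1 + r ^ 2)`; a
  -- shift by at most 1 stays within `C + 1` of `f`.
  obtain ⟨s, hs, hD⟩ := D.exists_crossesTransversally e hg₀
  set g : ℝ → ℝ := fun r => k * √(1 + r ^ 2) + s with hgdef
  have hg : Differentiable ℝ g := hg₀.add_const s
  have hgf : ∀ r, |g r - f r| ≤ C + 1 := fun r => by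
    have h1 := abs_le.1 (hfg r)
    rw [abs_le, hgdef]
    constructor <;> linarith [hs.1, hs.2]
  have hstrip : ∀ r, |frameY e (framePoint e r (g r)) - f (frameX e (framePoint e r (g r)))|
      ≤ C + 1 := fun r => by
    rw [frameX_framePoint he, frameY_framePoint he]; exact hgf r
  have hM : ∀ r, R₁ ≤ |r| → R₁ ≤ ‖framePoint e r (g r)‖ := fun r hr =>
    hr.trans (abs_le_norm_framePoint he _ _)
  have hmax : R₁ ≤ |max R₁ 1| := (le_max_left _ _).trans (le_abs_self _)
  have h1max : (1 : ℝ) ≤ max R₁ 1 := le_max_right _ _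
  refine hD.finsum_eq hg he (R := max R₁ 1) (by linarith) ?_ ?_ ?_ ?_
  · intro r hr
    by_contra! hcon
    exact (hR₁ _ (hM r ((le_max_left _ _).trans hcon)) (hstrip r)).1 hr
  · refine (hR₁ _ (hM _ hmax) (hstrip _)).2.1 ?_
    rw [frameX_framePoint he]; linarith
  · refine (hR₁ _ (hM _ (by rwa [abs_neg])) (hstrip _)).2.2 ?_
    rw [frameX_framePoint he]; linarith
  · intro i
    have hprop := (D.line_proper i).proper
    rw [← Metric.cobounded_eq_cocompact, ← Metric.cobounded_eq_cocompact] at hprop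
    have hfar : ∀ᶠ t in Bornology.cobounded ℝ, R₁ ≤ ‖D.line i t‖ :=
      hprop.eventually (tendsto_norm_cobounded_plane.eventually_ge_atTop R₁)
    obtain ⟨N, -, hN⟩ := hasBasis_cobounded_norm.eventually_iff.1 hfar
    have hev := hlim i
    -- Convergence in `ℤ` is eventual equality, so the limit is attained at some `b` beyond which
    -- the curve is also far out in both directions.
    rw [nhds_discrete, tendsto_pure] at hev
    obtain ⟨b, ⟨hb, hbN⟩, hb0⟩ :=
      ((hev.and (eventually_ge_atTop N)).and (eventually_ge_atTop 0)).exists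
    have hout : ∀ t, b ≤ |t| →
        C + 1 < |frameY e (D.line i t) - f (frameX e (D.line i t))| := by
      intro t ht
      by_contra! hcon
      have hNt : R₁ ≤ ‖D.line i t‖ := hN (show N ≤ ‖t‖ by rw [Real.norm_eq_abs]; linarith)
      exact (hR₁ _ hNt hcon).1 (D.curve_mem_frontier (Sum.inl i) t)
    have hind : ∀ t, b ≤ |t| → indicatorInt (frameEpigraph e f) (D.line i t) =
        if 0 ≤ heightAlong e g (D.line i) t then 1 else 0 := by
      intro t ht
      have h1 := hout t ht
      have h2 := abs_le.1 (hgf (frameX e (D.line i t)))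
      rcases lt_abs.1 h1 with h3 | h3
      · rw [if_pos (by rw [heightAlong]; linarith), indicatorInt_of_mem]
        change f _ ≤ _
        linarith
      · rw [if_neg (by rw [heightAlong]; linarith), indicatorInt_of_notMem]
        change ¬ f _ ≤ _
        linarith
    refine ⟨b, hb0, fun t ht hmem => ?_, ?_⟩
    · have h1 := hout t ht
      have h2 : frameY e (D.line i t) = g (frameX e (D.line i t)) := hmem
      rw [h2] at h1
      linarith [hgf (frameX e (D.line i t))]
    · rw [← hind b (le_abs_self b), ← hind (-b) (by rw [abs_neg]; exact le_abs_self b), hb]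

/-! ### Half-planes with corrected lattice points -/

lemma exists_frameX_ne (e : Plane) : ∃ c₀, ∀ z ∈ integerLattice, frameX e z ≠ c₀ := by
  obtain ⟨c₀, hc₀⟩ := (countable_integerLattice.image (frameX e)).dense_compl ℝ |>.nonempty
  exact ⟨c₀, fun z hz h => hc₀ ⟨z, hz, h⟩⟩

/-- The lattice points at which `U` differs from the half-plane `{c₀ < frameX e x}`. -/
def exceptionalPoints (U : Set Plane) (e : Plane) (c₀ : ℝ) : Set Plane :=
  {z | z ∈ integerLattice ∧ (z ∈ U ↔ frameX e z < c₀)}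

/-- The radius of the disc removed or added at an exceptional point. -/
noncomputable def discRadius (e : Plane) (c₀ : ℝ) (z : Plane) : ℝ :=
  min (1 / 4) (|frameX e z - c₀| / 2)

/-- A half-plane, corrected by small discs so as to contain the same lattice points as `U`. -/
def correctedHalfPlane (U : Set Plane) (e : Plane) (c₀ : ℝ) : Set Plane :=
  {x | (c₀ < frameX e x ∧
      ∀ z ∈ exceptionalPoints U e c₀, x ∉ Metric.closedBall z (discRadius e c₀ z)) ∨
    ∃ z ∈ exceptionalPoints U e c₀, z ∈ U ∧ x ∈ Metric.ball z (discRadius e c₀ z)}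

section

variable {U : Set Plane} {e : Plane} {c₀ : ℝ}

lemma discRadius_le (z : Plane) : discRadius e c₀ z ≤ 1 / 4 := min_le_left _ _

lemma discRadius_pos {z : Plane} (hz : frameX e z ≠ c₀) : 0 < discRadius e c₀ z :=
  lt_min (by norm_num) (by have := abs_pos.2 (sub_ne_zero.2 hz); positivity)

/-- The radius is at most half the distance from `z` to the line, so the closed disc stays strictly
on the side of its centre. -/
lemma frameX_of_mem_disc (he : ‖e‖ = 1) {x z : Plane} (hz : frameX e z ≠ c₀)
    (hx : x ∈ Metric.closedBall z (discRadius e c₀ z)) :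
    (frameX e z < c₀ ∧ frameX e x < c₀) ∨ (c₀ < frameX e z ∧ c₀ < frameX e x) := by
  have h1 := (abs_frameX_sub_le he x z).trans hx
  have h2 : discRadius e c₀ z ≤ |frameX e z - c₀| / 2 := min_le_right _ _
  have h3 := abs_le.1 (h1.trans h2)
  rcases hz.lt_or_gt with h | h
  · rw [abs_of_neg (sub_neg.2 h)] at h3
    exact Or.inl ⟨h, by linarith [h3.2]⟩
  · rw [abs_of_pos (sub_pos.2 h)] at h3
    exact Or.inr ⟨h, by linarith [h3.1]⟩

lemma disc_index_unique {x z w : Plane} (hz : z ∈ integerLattice) (hw : w ∈ integerLattice)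
    (hxz : x ∈ Metric.closedBall z (discRadius e c₀ z))
    (hxw : x ∈ Metric.closedBall w (discRadius e c₀ w)) : z = w := by
  apply eq_of_dist_lt_one hz hw
  have h1 : dist x z ≤ _ := hxz
  have h2 : dist x w ≤ _ := hxw
  have h3 := discRadius_le (e := e) (c₀ := c₀) z
  have h4 := discRadius_le (e := e) (c₀ := c₀) w
  have := dist_triangle_left z w x
  linarith

lemma locallyFinite_discs :
    LocallyFinite fun z : exceptionalPoints U e c₀ =>
      Metric.closedBall (z : Plane) (discRadius e c₀ z) := by
  intro x
  refine ⟨Metric.ball x (1 / 4), Metric.ball_mem_nhds x (by norm_num), ?_⟩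
  apply Set.Subsingleton.finite
  rintro z ⟨y, hyz, hyx⟩ w ⟨y', hyw, hyx'⟩
  apply Subtype.ext
  apply eq_of_dist_lt_one z.2.1 w.2.1
  have h1 : dist y z ≤ _ := hyz
  have h2 : dist y' w ≤ _ := hyw
  have h3 := discRadius_le (e := e) (c₀ := c₀) z
  have h4 := discRadius_le (e := e) (c₀ := c₀) w
  have h5 : dist y x < 1 / 4 := hyx
  have h6 : dist y' x < 1 / 4 := hyx'
  have h7 := dist_triangle4 (z : Plane) y y' w
  have h8 := dist_triangle_right y y' x
  rw [dist_comm (z : Plane) y] at h7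
  linarith

lemma eventually_notMem_discs {x : Plane} {E : Set Plane} (hE : E ⊆ exceptionalPoints U e c₀)
    (hx : ∀ z ∈ E, x ∉ Metric.closedBall z (discRadius e c₀ z)) :
    ∀ᶠ y in 𝓝 x, ∀ z ∈ E, y ∉ Metric.closedBall z (discRadius e c₀ z) := by
  have hlf : LocallyFinite ((fun z : exceptionalPoints U e c₀ =>
      Metric.closedBall (z : Plane) (discRadius e c₀ z)) ∘ Set.inclusion hE) :=
    locallyFinite_discs.comp_injective (Set.inclusion_injective hE)
  have hcl := hlf.isClosed_iUnion fun z => Metric.isClosed_closedBall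
  have hmem : x ∉ ⋃ z : E, ((fun z : exceptionalPoints U e c₀ =>
      Metric.closedBall (z : Plane) (discRadius e c₀ z)) ∘ Set.inclusion hE) z := by
    rw [mem_iUnion]
    rintro ⟨z, hz⟩
    exact hx z z.2 hz
  filter_upwards [hcl.isOpen_compl.mem_nhds hmem] with y hy z hz hyz
  exact hy (mem_iUnion.2 ⟨(⟨z, hz⟩ : E), hyz⟩)

lemma eventually_mem_correctedHalfPlane_off {x : Plane}
    (hx : ∀ z ∈ exceptionalPoints U e c₀, x ∉ Metric.closedBall z (discRadius e c₀ z)) :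
    ∀ᶠ y in 𝓝 x, y ∈ correctedHalfPlane U e c₀ ↔ c₀ < frameX e y := by
  filter_upwards [eventually_notMem_discs subset_rfl hx] with y hy
  constructor
  · rintro (h | ⟨z, hz, -, h⟩)
    · exact h.1
    · exact absurd (Metric.ball_subset_closedBall h) (hy z hz)
  · exact fun h => Or.inl ⟨h, hy⟩

/-- The other closed discs form a locally finite family that misses `x`, and `x` lies strictly on
one side of the line. So near `x` only the disc about `z` matters: it is added if `z ∈ U` and
removed otherwise. -/
lemma eventually_mem_correctedHalfPlane_disc (he : ‖e‖ = 1)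
    (hc₀ : ∀ z ∈ integerLattice, frameX e z ≠ c₀) {x z : Plane}
    (hz : z ∈ exceptionalPoints U e c₀) (hx : x ∈ Metric.closedBall z (discRadius e c₀ z)) :
    ∀ᶠ y in 𝓝 x, y ∈ correctedHalfPlane U e c₀ ↔
      (z ∈ U ∧ dist y z < discRadius e c₀ z) ∨ (z ∉ U ∧ discRadius e c₀ z < dist y z) := by
  have hoff := eventually_notMem_discs (U := U) (e := e) (c₀ := c₀) (x := x)
    (E := exceptionalPoints U e c₀ \ {z}) sdiff_subset
    fun w hw hxw => hw.2 (disc_index_unique hw.1.1 hz.1 hxw hx)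
  have hXc := (continuous_frameX e).continuousAt (x := x)
  rcases frameX_of_mem_disc he (hc₀ z hz.1) hx with ⟨h1, h2⟩ | ⟨h1, h2⟩
  · have hzU : z ∈ U := hz.2.2 h1
    filter_upwards [hoff, hXc.eventually (gt_mem_nhds h2)] with y hy hyX
    simp only [hzU, true_and, not_true_eq_false, false_and, or_false]
    constructor
    · rintro (h | ⟨w, hw, -, h⟩)
      · exact absurd h.1 hyX.not_gt
      · by_cases hwz : w = z
        · subst hwz; exact h
        · exact absurd (Metric.ball_subset_closedBall h) (hy w ⟨hw, hwz⟩)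
    · exact fun h => Or.inr ⟨z, hz, hzU, h⟩
  · have hzU : z ∉ U := fun h => h1.not_gt (hz.2.1 h)
    filter_upwards [hoff, hXc.eventually (lt_mem_nhds h2)] with y hy hyX
    simp only [hzU, false_and, not_false_eq_true, true_and, false_or]
    constructor
    · rintro (h | ⟨w, hw, hwU, h⟩)
      · exact not_le.1 (h.2 z hz)
      · by_cases hwz : w = z
        · subst hwz; exact absurd hwU hzU
        · exact absurd (Metric.ball_subset_closedBall h) (hy w ⟨hw, hwz⟩)
    · intro h
      refine Or.inl ⟨hyX, fun w hw => ?_⟩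
      by_cases hwz : w = z
      · subst hwz; exact not_le.2 h
      · exact hy w ⟨hw, hwz⟩

lemma correctedHalfPlane_inter_integerLattice (he : ‖e‖ = 1)
    (hc₀ : ∀ z ∈ integerLattice, frameX e z ≠ c₀) :
    correctedHalfPlane U e c₀ ∩ integerLattice = U ∩ integerLattice := by
  ext x
  simp only [mem_inter_iff, and_congr_left_iff]
  intro hx
  by_cases hxE : x ∈ exceptionalPoints U e c₀
  · have hr := discRadius_pos (hc₀ x hx)
    have h := (eventually_mem_correctedHalfPlane_disc he hc₀ hxE
      (Metric.mem_closedBall_self hr.le)).self_of_nhds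
    simpa [hr, hr.le.not_gt] using h
  · have hoff : ∀ z ∈ exceptionalPoints U e c₀,
        x ∉ Metric.closedBall z (discRadius e c₀ z) := by
      intro z hz hxz
      have h1 : dist x z ≤ _ := hxz
      have h2 := discRadius_le (e := e) (c₀ := c₀) z
      have := eq_of_dist_lt_one hx hz.1 (by linarith)
      exact hxE (this ▸ hz)
    rw [(eventually_mem_correctedHalfPlane_off hoff).self_of_nhds]
    have hiff : ¬ (x ∈ U ↔ frameX e x < c₀) := fun h => hxE ⟨hx, h⟩
    have hne := hc₀ x hx
    rcases hne.lt_or_gt with h | h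
    · simp only [h, iff_true] at hiff
      exact iff_of_false h.not_gt hiff
    · simp only [h.not_gt, iff_false, not_not] at hiff
      exact iff_of_true h hiff

/-! ### The boundary curves of a corrected half-plane -/

lemma rotLeft_framePoint (e : Plane) (a b : ℝ) :
    rotLeft (framePoint e a b) = framePoint e (-b) a := by
  apply Plane.ext <;> simp <;> ring

lemma norm_framePoint_sq (he : ‖e‖ = 1) (a b : ℝ) : ‖framePoint e a b‖ ^ 2 = a ^ 2 + b ^ 2 := by
  rw [norm_sq_eq_frame he, frameX_framePoint he, frameY_framePoint he]

lemma framePoint_inj (he : ‖e‖ = 1) {a b a' b' : ℝ} (h : framePoint e a b = framePoint e a' b') :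
    a = a' ∧ b = b' := by
  have h1 := congrArg (frameX e) h
  have h2 := congrArg (frameY e) h
  rw [frameX_framePoint he, frameX_framePoint he] at h1
  rw [frameY_framePoint he, frameY_framePoint he] at h2
  exact ⟨h1, h2⟩

/-- The line `frameX e x = c₀`, with the half-plane `{c₀ < frameX e x}` to its left. -/
noncomputable def frameLine (e : Plane) (c₀ t : ℝ) : Plane := framePoint e c₀ (-t)

/-- A circle, counterclockwise for `σ = 1` and clockwise for `σ = -1`. -/
noncomputable def frameCircle (e z : Plane) (ρ σ t : ℝ) : Plane :=
  z + framePoint e (ρ * Real.cos t) (σ * (ρ * Real.sin t))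

lemma hasDerivAt_frameLine (e : Plane) (c₀ t : ℝ) :
    HasDerivAt (frameLine e c₀) (framePoint e 0 (-1)) t := by
  unfold frameLine framePoint
  have h1 : HasDerivAt (fun t : ℝ => (-t) • rotLeft e) ((-1 : ℝ) • rotLeft e) t :=
    (hasDerivAt_neg t).smul_const _
  simpa using h1.const_add (c₀ • e)

lemma hasDerivAt_frameCircle (e z : Plane) (ρ σ t : ℝ) :
    HasDerivAt (frameCircle e z ρ σ)
      (framePoint e (-(ρ * Real.sin t)) (σ * (ρ * Real.cos t))) t := by
  unfold frameCircle framePoint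
  have h1 : HasDerivAt (fun t => ρ * Real.cos t) (-(ρ * Real.sin t)) t := by
    simpa using (Real.hasDerivAt_cos t).const_mul ρ
  have h2 : HasDerivAt (fun t => σ * (ρ * Real.sin t)) (σ * (ρ * Real.cos t)) t :=
    ((Real.hasDerivAt_sin t).const_mul ρ).const_mul σ
  exact ((h1.smul_const e).add (h2.smul_const (rotLeft e))).const_add z

lemma isProperSimpleCurve_frameLine (he : ‖e‖ = 1) (c₀ : ℝ) :
    IsProperSimpleCurve (frameLine e c₀) where
  continuous := by unfold frameLine framePoint; fun_prop
  injective := fun s t h => by simpa using (framePoint_inj he h).2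
  proper := by
    rw [← Metric.cobounded_eq_cocompact, ← Metric.cobounded_eq_cocompact,
      ← tendsto_norm_atTop_iff_cobounded]
    refine tendsto_atTop_mono (fun t => ?_) (tendsto_norm_cobounded_atTop (E := ℝ))
    rw [Real.norm_eq_abs]
    apply abs_le_of_sq_le_sq _ (norm_nonneg _)
    rw [frameLine, norm_framePoint_sq he]
    nlinarith [sq_nonneg c₀]
  piecewiseRegular := by
    refine ⟨∅, by simp, ?_, fun t _ => ?_⟩
    · apply ContDiff.contDiffOn
      unfold frameLine framePoint
      fun_prop
    · rw [(hasDerivAt_frameLine e c₀ t).deriv]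
      intro h
      have := norm_framePoint_sq he 0 (-1)
      rw [h] at this
      norm_num at this

lemma dist_frameCircle (he : ‖e‖ = 1) (z : Plane) {ρ σ : ℝ} (hρ : 0 < ρ) (hσ : σ ^ 2 = 1)
    (t : ℝ) : dist (frameCircle e z ρ σ t) z = ρ := by
  rw [dist_eq_norm, frameCircle, add_sub_cancel_left, ← sq_eq_sq₀ (norm_nonneg _) hρ.le,
    norm_framePoint_sq he]
  have := Real.sin_sq_add_cos_sq t
  linear_combination ρ ^ 2 * this + (ρ * Real.sin t) ^ 2 * hσ

lemma isSimpleClosedCurve_frameCircle (he : ‖e‖ = 1) (z : Plane) {ρ σ : ℝ} (hρ : 0 < ρ)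
    (hσ : σ ^ 2 = 1) : IsSimpleClosedCurve (frameCircle e z ρ σ) where
  continuous := by unfold frameCircle framePoint; fun_prop
  periodic := by
    refine ⟨2 * Real.pi, Real.two_pi_pos, fun t => ?_, ?_⟩
    · simp [frameCircle]
    · intro s hs t ht h
      obtain ⟨h1, h2⟩ := framePoint_inj he (add_left_cancel h)
      have hσ0 : σ ≠ 0 := by rintro rfl; norm_num at hσ
      have h3 := Real.Angle.cos_sin_inj (mul_left_cancel₀ hρ.ne' h1)
        (mul_left_cancel₀ hρ.ne' (mul_left_cancel₀ hσ0 h2))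
      obtain ⟨n, hn⟩ := Real.Angle.angle_eq_iff_two_pi_dvd_sub.1 h3
      have hpi := Real.pi_pos
      have e1 : (n : ℝ) < 1 := by nlinarith [hs.2, ht.1]
      have e2 : (-1 : ℝ) < n := by nlinarith [hs.1, ht.2]
      have e1' : n < 1 := by exact_mod_cast e1
      have e2' : -1 < n := by exact_mod_cast e2
      have : n = 0 := by omega
      rw [this] at hn
      simp only [Int.cast_zero, mul_zero] at hn
      linarith
  piecewiseRegular := by
    refine ⟨∅, by simp, ?_, fun t _ => ?_⟩
    · apply ContDiff.contDiffOn
      unfold frameCircle framePoint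
      fun_prop
    · rw [(hasDerivAt_frameCircle e z ρ σ t).deriv]
      intro h
      have h1 := norm_framePoint_sq he (-(ρ * Real.sin t)) (σ * (ρ * Real.cos t))
      rw [h, norm_zero] at h1
      have h2 := Real.sin_sq_add_cos_sq t
      have h3 : ρ ^ 2 = 0 := by
        linear_combination (-ρ ^ 2) * h2 - h1 - (ρ * Real.cos t) ^ 2 * hσ
      exact hρ.ne' (by simpa using h3)

lemma mem_range_frameCircle (he : ‖e‖ = 1) {x z : Plane} {ρ σ : ℝ} (hσ : σ ^ 2 = 1)
    (hx : dist x z = ρ) : x ∈ range (frameCircle e z ρ σ) := by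
  -- The factor `σ` reflects a clockwise circle to a counterclockwise one, so that the argument of
  -- `w` is a parameter of the point.
  set w : ℂ := ⟨frameX e (x - z), σ * frameY e (x - z)⟩ with hw
  have hnorm : ‖w‖ = ρ := by
    rw [← hx, dist_eq_norm, ← sq_eq_sq₀ (norm_nonneg _) (norm_nonneg _), Complex.sq_norm,
      Complex.normSq_apply, norm_sq_eq_frame he]
    simp only [hw]
    linear_combination frameY e (x - z) ^ 2 * hσ
  refine ⟨w.arg, ?_⟩
  have h1 := Complex.norm_mul_cos_arg w
  have h2 := Complex.norm_mul_sin_arg w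
  rw [hnorm] at h1 h2
  rw [frameCircle, h1, h2]
  have h3 : σ * w.im = frameY e (x - z) := by
    simp only [hw]; linear_combination frameY e (x - z) * hσ
  rw [h3, framePoint_frame he, add_sub_cancel]

/-- The orientation of the boundary circle of a disc: counterclockwise if the disc is added. -/
noncomputable def discSign (U : Set Plane) (z : Plane) : ℝ := by
  classical exact if z ∈ U then 1 else -1

lemma discSign_sq (z : Plane) : discSign U z ^ 2 = 1 := by
  unfold discSign; split_ifs <;> norm_num

lemma discSign_of_mem {z : Plane} (h : z ∈ U) : discSign U z = 1 := if_pos h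
lemma discSign_of_notMem {z : Plane} (h : z ∉ U) : discSign U z = -1 := if_neg h

lemma frameLine_notMem_disc (he : ‖e‖ = 1) (hc₀ : ∀ z ∈ integerLattice, frameX e z ≠ c₀) (t : ℝ)
    {z : Plane} (hz : z ∈ integerLattice) :
    frameLine e c₀ t ∉ Metric.closedBall z (discRadius e c₀ z) := by
  intro h
  rcases frameX_of_mem_disc he (hc₀ z hz) h with ⟨-, h⟩ | ⟨-, h⟩ <;>
  · rw [frameLine, frameX_framePoint he] at h
    exact h.false

lemma liesToLeft_frameLine (he : ‖e‖ = 1) (hc₀ : ∀ z ∈ integerLattice, frameX e z ≠ c₀) :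
    LiesToLeft (correctedHalfPlane U e c₀) (frameLine e c₀) := by
  intro t v hv _
  obtain rfl := hv.unique (hasDerivAt_frameLine e c₀ t)
  have hev := eventually_mem_correctedHalfPlane_off (U := U) (e := e) (c₀ := c₀)
    fun z hz => frameLine_notMem_disc he hc₀ t hz.1
  have hlim : ∀ τ : ℝ, Tendsto (fun ε : ℝ => frameLine e c₀ t +
      (τ * ε) • rotLeft (framePoint e 0 (-1))) (𝓝[>] 0) (𝓝 (frameLine e c₀ t)) := by
    intro τ
    have : Continuous fun ε : ℝ => frameLine e c₀ t + (τ * ε) • rotLeft (framePoint e 0 (-1)) := by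
      fun_prop
    simpa using (this.tendsto 0).mono_left nhdsWithin_le_nhds
  have hX : ∀ τ ε : ℝ, frameX e (frameLine e c₀ t + (τ * ε) • rotLeft (framePoint e 0 (-1))) =
      c₀ + τ * ε := by
    intro τ ε
    rw [rotLeft_framePoint, frameX_add, frameX_smul, frameLine, frameX_framePoint he,
      frameX_framePoint he]
    ring
  filter_upwards [(hlim 1).eventually hev, (hlim (-1)).eventually hev, self_mem_nhdsWithin]
    with ε h1 h2 h3
  have hε : 0 < ε := h3
  rw [hX] at h1 h2
  rw [one_mul] at h1
  rw [neg_one_mul, neg_smul, ← sub_eq_add_neg] at h2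
  exact ⟨h1.2 (by linarith), fun h => by linarith [h2.1 h]⟩

lemma liesToLeft_frameCircle (he : ‖e‖ = 1) (hc₀ : ∀ z ∈ integerLattice, frameX e z ≠ c₀)
    {z : Plane} (hz : z ∈ exceptionalPoints U e c₀) :
    LiesToLeft (correctedHalfPlane U e c₀)
      (frameCircle e z (discRadius e c₀ z) (discSign U z)) := by
  intro t v hv _
  set ρ := discRadius e c₀ z with hρ
  set σ := discSign U z with hσdef
  have hρ0 : 0 < ρ := discRadius_pos (hc₀ z hz.1)
  have hσ : σ ^ 2 = 1 := discSign_sq z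
  obtain rfl := hv.unique (hasDerivAt_frameCircle e z ρ σ t)
  set x := frameCircle e z ρ σ t with hx
  have hdist : dist x z = ρ := dist_frameCircle he z hρ0 hσ t
  have hev := eventually_mem_correctedHalfPlane_disc he hc₀ hz (x := x) hdist.le
  -- The left normal points towards the centre of an added disc and away from the centre of a
  -- removed one.
  have hrot : rotLeft (framePoint e (-(ρ * Real.sin t)) (σ * (ρ * Real.cos t))) =
      (-σ) • (x - z) := by
    rw [rotLeft_framePoint, hx, frameCircle, add_sub_cancel_left]
    apply Plane.ext
    · simp only [framePoint_zero, PiLp.smul_apply, smul_eq_mul]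
      linear_combination (-(ρ * Real.sin t * e 1)) * hσ
    · simp only [framePoint_one, PiLp.smul_apply, smul_eq_mul]
      linear_combination (ρ * Real.sin t * e 0) * hσ
  rw [hrot]
  have hlim : ∀ τ : ℝ, Tendsto (fun ε : ℝ => x + (τ * ε) • (-σ) • (x - z)) (𝓝[>] 0) (𝓝 x) := by
    intro τ
    have : Continuous fun ε : ℝ => x + (τ * ε) • (-σ) • (x - z) := by fun_prop
    simpa using (this.tendsto 0).mono_left nhdsWithin_le_nhds
  have hd : ∀ τ ε : ℝ, dist (x + (τ * ε) • (-σ) • (x - z)) z = |1 - τ * ε * σ| * ρ := by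
    intro τ ε
    have : x + (τ * ε) • (-σ) • (x - z) - z = (1 - τ * ε * σ) • (x - z) := by
      module
    rw [dist_eq_norm, this, norm_smul, Real.norm_eq_abs, ← dist_eq_norm, hdist]
  have hsmall : ∀ᶠ ε in 𝓝[>] (0 : ℝ), ε < 1 :=
    eventually_nhdsWithin_of_eventually_nhds (gt_mem_nhds zero_lt_one)
  filter_upwards [(hlim 1).eventually hev, (hlim (-1)).eventually hev, self_mem_nhdsWithin,
    hsmall] with ε h1 h2 h3 h4
  have hε : 0 < ε := h3
  rw [hd] at h1 h2
  rw [one_mul] at h1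
  rw [neg_one_mul, neg_smul, ← sub_eq_add_neg] at h2
  rw [h1, h2]
  by_cases hzU : z ∈ U
  · have : σ = 1 := discSign_of_mem hzU
    simp only [this, hzU, true_and, not_true_eq_false, false_and, or_false, mul_one]
    rw [abs_of_pos (by linarith), abs_of_pos (by linarith)]
    constructor <;> nlinarith
  · have : σ = -1 := discSign_of_notMem hzU
    simp only [this, hzU, true_and, not_false_eq_true, false_and, false_or]
    rw [abs_of_pos (by linarith), abs_of_pos (by linarith)]
    constructor <;> nlinarith

/-- A point of a differentiable curve is a boundary point of a set that lies to its left. -/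
lemma LiesToLeft.mem_frontier {S : Set Plane} {γ : ℝ → Plane} (h : LiesToLeft S γ) {t : ℝ}
    {v : Plane} (hv : HasDerivAt γ v t) (hv0 : v ≠ 0) : γ t ∈ frontier S := by
  have hev := h t v hv hv0
  rw [frontier_eq_closure_inter_closure]
  constructor
  · have : Continuous fun ε : ℝ => γ t + ε • rotLeft v := by fun_prop
    refine mem_closure_of_tendsto (b := 𝓝[>] (0 : ℝ)) (f := fun ε : ℝ => γ t + ε • rotLeft v)
      (by simpa using (this.tendsto 0).mono_left nhdsWithin_le_nhds) (hev.mono fun ε h => h.1)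
  · have : Continuous fun ε : ℝ => γ t - ε • rotLeft v := by fun_prop
    refine mem_closure_of_tendsto (b := 𝓝[>] (0 : ℝ)) (f := fun ε : ℝ => γ t - ε • rotLeft v)
      (by simpa using (this.tendsto 0).mono_left nhdsWithin_le_nhds) (hev.mono fun ε h => h.2)

lemma notMem_frontier_of_eventually_iff {S : Set Plane} {x : Plane} {p : Prop}
    (h : ∀ᶠ y in 𝓝 x, y ∈ S ↔ p) : x ∉ frontier S := by
  rw [frontier_eq_closure_inter_closure]
  rintro ⟨h1, h2⟩
  rw [mem_closure_iff_frequently] at h1 h2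
  obtain ⟨y, hy, hy'⟩ := (h1.and_eventually h).exists
  obtain ⟨w, hw, hw'⟩ := (h2.and_eventually h).exists
  exact hw (hw'.2 (hy'.1 hy))

/-- The curve bounding a corrected half-plane, or one of its discs. -/
noncomputable def correctedCurve (U : Set Plane) (e : Plane) (c₀ : ℝ) :
    Unit ⊕ exceptionalPoints U e c₀ → ℝ → Plane :=
  Sum.elim (fun _ => frameLine e c₀)
    fun z => frameCircle e z (discRadius e c₀ z) (discSign U z)

lemma range_frameCircle_subset (he : ‖e‖ = 1) (hc₀ : ∀ z ∈ integerLattice, frameX e z ≠ c₀)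
    {z : Plane} (hz : z ∈ integerLattice) :
    range (frameCircle e z (discRadius e c₀ z) (discSign U z)) ⊆
      Metric.closedBall z (discRadius e c₀ z) := by
  rintro x ⟨t, rfl⟩
  exact (dist_frameCircle he z (discRadius_pos (hc₀ z hz)) (discSign_sq z) t).le

lemma frontier_correctedHalfPlane (he : ‖e‖ = 1)
    (hc₀ : ∀ z ∈ integerLattice, frameX e z ≠ c₀) :
    frontier (correctedHalfPlane U e c₀) = ⋃ a, range (correctedCurve U e c₀ a) := by
  apply Subset.antisymm
  · intro x hx
    rw [mem_iUnion]
    by_cases hoff : ∀ z ∈ exceptionalPoints U e c₀,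
        x ∉ Metric.closedBall z (discRadius e c₀ z)
    · refine ⟨Sum.inl (), -frameY e x, ?_⟩
      have hX : frameX e x = c₀ := by
        by_contra hne
        have hev := eventually_mem_correctedHalfPlane_off hoff
        have hXc := (continuous_frameX e).continuousAt (x := x)
        rcases Ne.lt_or_gt hne with h | h
        · refine notMem_frontier_of_eventually_iff (p := False) ?_ hx
          filter_upwards [hev, hXc.eventually (gt_mem_nhds h)] with y h1 h2
          rw [h1, iff_false]
          exact h2.not_gt
        · refine notMem_frontier_of_eventually_iff (p := True) ?_ hx
          filter_upwards [hev, hXc.eventually (lt_mem_nhds h)] with y h1 h2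
          rw [h1, iff_true]
          exact h2
      change framePoint e c₀ (- -frameY e x) = x
      rw [neg_neg, ← hX, framePoint_frame he]
    · push Not at hoff
      obtain ⟨z, hz, hxz⟩ := hoff
      refine ⟨Sum.inr ⟨z, hz⟩, mem_range_frameCircle he (discSign_sq z) ?_⟩
      by_contra hne
      have hlt : dist x z < discRadius e c₀ z := lt_of_le_of_ne hxz hne
      refine notMem_frontier_of_eventually_iff (p := z ∈ U) ?_ hx
      have hc : Continuous fun y => dist y z := by fun_prop
      filter_upwards [eventually_mem_correctedHalfPlane_disc he hc₀ hz hxz,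
        hc.continuousAt.eventually (gt_mem_nhds hlt)] with y h1 h2
      rw [h1]
      simp [h2, h2.le.not_gt]
  · refine iUnion_subset ?_
    rintro (_ | z) _ ⟨t, rfl⟩
    · refine (liesToLeft_frameLine he hc₀).mem_frontier (hasDerivAt_frameLine e c₀ t) fun h => ?_
      have := norm_framePoint_sq he 0 (-1)
      rw [h] at this
      norm_num at this
    · refine (liesToLeft_frameCircle he hc₀ z.2).mem_frontier
        (hasDerivAt_frameCircle e z _ _ t) fun h => ?_
      have h1 := norm_framePoint_sq he (-(discRadius e c₀ z * Real.sin t))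
        (discSign U z * (discRadius e c₀ z * Real.cos t))
      rw [h, norm_zero] at h1
      have h2 := Real.sin_sq_add_cos_sq t
      have h3 : discRadius e c₀ z ^ 2 = 0 := by
        linear_combination (-discRadius e c₀ z ^ 2) * h2 - h1 -
          (discRadius e c₀ z * Real.cos t) ^ 2 * discSign_sq (U := U) (z : Plane)
      exact (discRadius_pos (hc₀ z z.2.1)).ne' (by simpa using h3)

/-- A corrected half-plane is bounded by a line and by disjoint small circles. -/
noncomputable def correctedBoundaryCurves (U : Set Plane) (he : ‖e‖ = 1)
    (hc₀ : ∀ z ∈ integerLattice, frameX e z ≠ c₀) :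
    BoundaryCurves (correctedHalfPlane U e c₀) where
  ι := Unit
  κ := exceptionalPoints U e c₀
  line := fun _ => frameLine e c₀
  loop := fun z => frameCircle e z (discRadius e c₀ z) (discSign U z)
  line_proper := fun _ => isProperSimpleCurve_frameLine he c₀
  loop_closed := fun z => isSimpleClosedCurve_frameCircle he z (discRadius_pos (hc₀ z z.2.1))
    (discSign_sq z)
  disjoint := by
    rintro (a | z) (b | w) hne
    · exact absurd rfl hne
    · rw [Set.disjoint_left]
      rintro x ⟨t, rfl⟩ hx
      exact frameLine_notMem_disc he hc₀ t w.2.1 (range_frameCircle_subset he hc₀ w.2.1 hx)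
    · rw [Set.disjoint_right]
      rintro x ⟨t, rfl⟩ hx
      exact frameLine_notMem_disc he hc₀ t z.2.1 (range_frameCircle_subset he hc₀ z.2.1 hx)
    · rw [Set.disjoint_left]
      intro x hx hx'
      apply hne
      congr 1
      exact Subtype.ext (disc_index_unique z.2.1 w.2.1 (range_frameCircle_subset he hc₀ z.2.1 hx)
        (range_frameCircle_subset he hc₀ w.2.1 hx'))
  locallyFinite := by
    intro x
    obtain ⟨N, hN, hfin⟩ := (locallyFinite_discs (U := U) (e := e) (c₀ := c₀)).subset
      (fun z => range_frameCircle_subset (U := U) he hc₀ z.2.1) x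
    refine ⟨N, hN, (((finite_univ (α := Unit)).image Sum.inl).union
      (hfin.image Sum.inr)).subset ?_⟩
    rintro (a | z) h
    · exact Or.inl ⟨a, trivial, rfl⟩
    · exact Or.inr ⟨z, h, rfl⟩
  frontier_eq := frontier_correctedHalfPlane he hc₀
  left := by
    rintro (a | z)
    · exact liesToLeft_frameLine he hc₀
    · exact liesToLeft_frameCircle he hc₀ z.2

/-! ### Existence of the intersection number -/

/-- In the large discs about the far points of the graph, `U` agrees with the half-plane at lattice
points, so boundary points lying well inside such a disc cannot belong to a correction circle. The
line itself has fixed abscissa. -/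
lemma transverse_correctedHalfPlane (he : ‖e‖ = 1)
    (hc₀ : ∀ z ∈ integerLattice, frameX e z ≠ c₀) {f : ℝ → ℝ} (hf : Continuous f) {A B : ℝ}
    (hfg : ∀ r, |f r| ≤ A * |r| + B) {c β R : ℝ} (hc : 0 < c) (hβ : 0 < β) (hβ1 : β ≤ 1)
    (hpos : ∀ r, R ≤ r → Metric.ball (framePoint e r (f r)) (c * |r| ^ β) ⊆ U)
    (hneg : ∀ r, r ≤ -R → Metric.ball (framePoint e r (f r)) (c * |r| ^ β) ⊆ Uᶜ) :
    Transverse (correctedHalfPlane U e c₀) (frameEpigraph e f) := by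
  have hfr := frontier_correctedHalfPlane (U := U) he hc₀
  have hgrow : Tendsto (fun r : ℝ => c / 2 * r ^ β) atTop atTop :=
    (tendsto_rpow_atTop hβ).const_mul_atTop (by positivity)
  -- The bound `1 / 4` ensures that a correction circle meeting the half-size disc has its centre in
  -- the full disc; `2 * |c₀| + 1` keeps that centre on the expected side of the line, and the line
  -- out of the disc.
  obtain ⟨R', hR'⟩ := (((hgrow.eventually_ge_atTop (1 / 4)).and (eventually_ge_atTop R)).and
    ((eventually_ge_atTop 1).and (eventually_ge_atTop (2 * |c₀| + 1)))).exists_forall_of_atTop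
  refine transverse_frameEpigraph (c := min (c / 2) (1 / 2)) (R := R') ?_ he hf hfg
    (by positivity) hβ hβ1 ?_
  · rw [hfr]
    exact ⟨frameLine e c₀ 0, mem_iUnion.2 ⟨Sum.inl (), 0, rfl⟩⟩
  · intro r hr x hx hball
    obtain ⟨⟨h1, h2⟩, h3, h4⟩ := hR' |r| hr
    have hpow : |r| ^ β ≤ |r| := Real.rpow_le_self_of_one_le h3 hβ1
    have hpow0 : 0 ≤ |r| ^ β := by positivity
    have hd : dist x (framePoint e r (f r)) < min (c / 2) (1 / 2) * |r| ^ β := hball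
    have hd1 : dist x (framePoint e r (f r)) < c / 2 * |r| ^ β :=
      hd.trans_le (by gcongr; exact min_le_left _ _)
    have hd2 : dist x (framePoint e r (f r)) < 1 / 2 * |r| ^ β :=
      hd.trans_le (by gcongr; exact min_le_right _ _)
    have hX := (abs_frameX_sub_le he x (framePoint e r (f r))).trans hd2.le
    rw [frameX_framePoint he, abs_le] at hX
    have hc1 := abs_le.1 (le_refl |c₀|)
    rw [hfr, mem_iUnion] at hx
    obtain ⟨_ | ⟨z, hz⟩, hx⟩ := hx
    · obtain ⟨t, rfl⟩ := hx
      change _ ≤ frameX e (framePoint e c₀ (-t)) - r ∧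
        frameX e (framePoint e c₀ (-t)) - r ≤ _ at hX
      rw [frameX_framePoint he] at hX
      rcases abs_cases r with ⟨hr1, hr2⟩ | ⟨hr1, hr2⟩ <;> linarith [hX.1, hX.2, hc1.1, hc1.2]
    · have hxz : dist x z ≤ 1 / 4 :=
        (show dist x z ≤ _ from range_frameCircle_subset (U := U) he hc₀ hz.1 hx).trans
          (discRadius_le z)
      have hzX := abs_le.1 ((abs_frameX_sub_le he x z).trans hxz)
      have hzball : z ∈ Metric.ball (framePoint e r (f r)) (c * |r| ^ β) := by
        rw [Metric.mem_ball]
        have := dist_triangle_left z (framePoint e r (f r)) x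
        linarith
      rcases abs_cases r with ⟨hr1, hr2⟩ | ⟨hr1, hr2⟩
      · have hzU := hz.2.1 (hpos r (by linarith) hzball)
        linarith [hX.1, hzX.2, hc1.2]
      · have hzU : ¬ frameX e z < c₀ := fun h => hneg r (by linarith) hzball (hz.2.2 h)
        linarith [hX.2, hzX.1, hc1.1]

theorem hasIntersectionNumber_neg_one (he : ‖e‖ = 1) {f : ℝ → ℝ} (hf : Continuous f) {A B : ℝ}
    (hfg : ∀ r, |f r| ≤ A * |r| + B) {c β R : ℝ} (hc : 0 < c) (hβ : 0 < β) (hβ1 : β ≤ 1)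
    (hpos : ∀ r, R ≤ r → Metric.ball (framePoint e r (f r)) (c * |r| ^ β) ⊆ U)
    (hneg : ∀ r, r ≤ -R → Metric.ball (framePoint e r (f r)) (c * |r| ^ β) ⊆ Uᶜ) :
    HasIntersectionNumber U (frameEpigraph e f) (-1) := by
  obtain ⟨c₀, hc₀⟩ := exists_frameX_ne e
  refine ⟨correctedHalfPlane U e c₀, correctedBoundaryCurves U he hc₀, fun _ => -1,
    correctedHalfPlane_inter_integerLattice he hc₀,
    transverse_correctedHalfPlane he hc₀ hf hfg hc hβ hβ1 hpos hneg, fun _ => ?_,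
    Set.finite_univ (α := Unit) |>.subset (subset_univ _), ?_⟩
  · rw [nhds_discrete, tendsto_pure]
    -- The line meets the graph only at height `f c₀`: it is below the graph at late times and on or
    -- above it at early ones.
    filter_upwards [eventually_gt_atTop (-f c₀), eventually_ge_atTop (f c₀)] with t h1 h2
    change indicatorInt _ (framePoint e c₀ (-t)) - indicatorInt _ (framePoint e c₀ (- -t)) = -1
    rw [indicatorInt_of_notMem, indicatorInt_of_mem]
    · norm_num
    · simpa [frameEpigraph, frameX_framePoint he, frameY_framePoint he] using h2
    · simp only [frameEpigraph, mem_ofPred_eq, frameX_framePoint he, frameY_framePoint he]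
      linarith
  · exact (finsum_unique (α := Unit) (fun _ => (-1 : ℤ))).symm

end

/-! ### Parabolic regions -/

/-- A parabolic region contains large discs about the points of its axis. -/
lemma IsParabolicRegion.exists_closedBall_subset {P : Set Plane} (hP : IsParabolicRegion P) :
    ∃ (p u : Plane) (β : ℝ), ‖u‖ = 1 ∧ 0 < β ∧ β ≤ 1 ∧
      ∀ s, 2 ≤ s → Metric.closedBall (p + s • u) (s ^ β / 2) ⊆ P := by
  obtain ⟨α, M, hα, rfl⟩ := hP
  set E : Plane := EuclideanSpace.single 0 1 with hE
  -- The exponent is capped at 1 so that a disc of radius `s ^ β / 2` stays in the half-plane `s / 2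
  -- ≤ y 0`, where the region has half-width at least `(s / 2) ^ β`.
  refine ⟨M 0, M.linearIsometryEquiv E, min α 1, ?_, by positivity, min_le_right _ _, ?_⟩
  · rw [LinearIsometryEquiv.norm_map, hE]; simp
  intro s hs x hx
  have hs1 : 1 ≤ s := by linarith
  refine ⟨M.symm x, ?_, M.apply_symm_apply x⟩
  have hMs : M 0 + s • M.linearIsometryEquiv E = M (s • E) := by
    have := M.map_vadd 0 (s • E)
    rw [vadd_eq_add, add_zero, vadd_eq_add, M.linearIsometryEquiv.map_smul] at this
    rw [this, add_comm]
  have hd : dist (M.symm x) (s • E) ≤ s ^ min α 1 / 2 := by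
    rw [← M.dist_map, M.apply_symm_apply, ← hMs]
    exact hx
  set y := M.symm x with hy
  have hcoord : ∀ i, |y i - (s • E) i| ≤ s ^ min α 1 / 2 := fun i => by
    refine le_trans ?_ hd
    rw [dist_eq_norm]
    simpa using PiLp.norm_apply_le (y - s • E) i
  have h0 := hcoord 0
  have h1 := hcoord 1
  simp only [hE, PiLp.smul_apply, PiLp.single_apply, smul_eq_mul, if_true, mul_one,
    one_ne_zero, if_false, mul_zero, sub_zero] at h0 h1
  have hpow : s ^ min α 1 ≤ s := Real.rpow_le_self_of_one_le hs1 (min_le_right _ _)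
  have hy0 : s / 2 ≤ y 0 := by linarith [(abs_le.1 h0).1]
  have hβ : 0 ≤ min α 1 := by positivity
  refine ⟨by linarith, h1.trans ?_⟩
  calc s ^ min α 1 / 2 ≤ s ^ min α 1 / 2 ^ min α 1 := by
        gcongr
        exact Real.rpow_le_self_of_one_le one_le_two (min_le_right _ _)
    _ = (s / 2) ^ min α 1 := (Real.div_rpow (by linarith) zero_le_two _).symm
    _ ≤ y 0 ^ min α 1 := by gcongr
    _ ≤ y 0 ^ α := Real.rpow_le_rpow_of_exponent_le (by linarith) (min_le_left _ _)

/-- The axes of disjoint parabolic regions have different directions. -/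
lemma ne_of_disjoint_tails {U : Set Plane} {p q u v : Plane} {β₁ β₂ : ℝ} (hβ₁ : 0 < β₁)
    (hp : ∀ s, 2 ≤ s → Metric.closedBall (p + s • u) (s ^ β₁ / 2) ⊆ U)
    (hq : ∀ s, 2 ≤ s → Metric.closedBall (q + s • v) (s ^ β₂ / 2) ⊆ Uᶜ) : u ≠ v := by
  rintro rfl
  -- With equal directions the axis points at the same parameter stay at distance `dist q p`, which
  -- the growing radius eventually exceeds.
  obtain ⟨s, hs, hs2⟩ := (((tendsto_rpow_atTop hβ₁).eventually_ge_atTop (2 * dist q p)).and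
    (eventually_ge_atTop 2)).exists
  have h1 : q + s • u ∈ Metric.closedBall (p + s • u) (s ^ β₁ / 2) := by
    rw [Metric.mem_closedBall, dist_add_right]; linarith
  have h2 : q + s • u ∈ Metric.closedBall (q + s • u) (s ^ β₂ / 2) :=
    Metric.mem_closedBall_self (by positivity)
  exact hq s hs2 h2 (hp s hs2 h1)

lemma frame_ext {e : Plane} (he : ‖e‖ = 1) {x y : Plane} (hX : frameX e x = frameX e y)
    (hY : frameY e x = frameY e y) : x = y := by
  rw [← framePoint_frame he x, hX, hY, framePoint_frame he]

/-- Two distinct directions are symmetric about the second axis of a suitable frame. -/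
lemma exists_symmetric_frame {u v : Plane} (hu : ‖u‖ = 1) (hv : ‖v‖ = 1) (huv : u ≠ v) :
    ∃ (e : Plane) (a b : ℝ), ‖e‖ = 1 ∧ 0 < a ∧ a ≤ 1 ∧ frameX e u = a ∧ frameX e v = -a ∧
      frameY e u = b ∧ frameY e v = b := by
  set d := ‖u - v‖ with hd
  have hd0 : 0 < d := norm_pos_iff.2 (sub_ne_zero.2 huv)
  -- For unit vectors `u + v` is orthogonal to `u - v`, which makes the abscissas opposite; the
  -- ordinates agree because `u - v` is parallel to the first axis.
  have he : ‖d⁻¹ • (u - v)‖ = 1 := by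
    rw [norm_smul, norm_inv, Real.norm_of_nonneg hd0.le, ← hd, inv_mul_cancel₀ hd0.ne']
  have hu2 := frame_sq hu
  have hv2 := frame_sq hv
  have hd2 := Plane.norm_sq (u - v)
  simp only [PiLp.sub_apply] at hd2
  have hXu : frameX (d⁻¹ • (u - v)) u = d / 2 := by
    simp only [frameX, PiLp.smul_apply, PiLp.sub_apply, smul_eq_mul]
    field_simp
    linear_combination hu2 - hv2 - hd2
  have hXv : frameX (d⁻¹ • (u - v)) v = -(d / 2) := by
    simp only [frameX, PiLp.smul_apply, PiLp.sub_apply, smul_eq_mul]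
    field_simp
    linear_combination hu2 - hv2 + hd2
  refine ⟨d⁻¹ • (u - v), d / 2, _, he, by positivity, ?_, hXu, hXv, rfl, ?_⟩
  · have := abs_frameX_le he u
    rw [hXu, hu] at this
    exact (le_abs_self _).trans this
  · simp only [frameY, PiLp.smul_apply, PiLp.sub_apply, smul_eq_mul]
    ring

/-! ### Two rays joined by a segment, as a graph -/

/-- The function with slope `-k` before `xq`, slope `k` after `xp`, slope `m` in between, and value
`yq` at `xq`. -/
noncomputable def bentGraph (xp xq yq m k r : ℝ) : ℝ :=
  yq + m * (max xq (min xp r) - xq) + k * max (r - xp) 0 + k * max (xq - r) 0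

lemma continuous_bentGraph (xp xq yq m k : ℝ) : Continuous (bentGraph xp xq yq m k) := by
  unfold bentGraph; fun_prop

section bentGraph

variable {xp xq yq m k r : ℝ}

lemma bentGraph_right (hpq : xq < xp) (hr : xp ≤ r) :
    bentGraph xp xq yq m k r = yq + m * (xp - xq) + k * (r - xp) := by
  rw [bentGraph, min_eq_left hr, max_eq_right hpq.le, max_eq_left (by linarith),
    max_eq_right (by linarith)]
  ring

lemma bentGraph_left (hpq : xq < xp) (hr : r ≤ xq) : bentGraph xp xq yq m k r = yq + k * (xq - r) := by
  rw [bentGraph, min_eq_right (by linarith), max_eq_left hr, max_eq_right (by linarith),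
    max_eq_left (by linarith)]
  ring

lemma bentGraph_middle (h1 : xq ≤ r) (h2 : r ≤ xp) :
    bentGraph xp xq yq m k r = yq + m * (r - xq) := by
  rw [bentGraph, min_eq_right h2, max_eq_right h1, max_eq_right (by linarith),
    max_eq_right (by linarith)]
  ring

/-- Both functions have slopes `-k` and `k` near the two ends. The bounded difference is what allows
a smooth graph to replace the bent one when crossings are counted. -/
lemma abs_bentGraph_sub_le (hpq : xq < xp) :
    |bentGraph xp xq yq m k r - k * √(1 + r ^ 2)| ≤
    |yq| + |m| * (xp - xq) + |k| * (|xp| + |xq| + 1) := by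
  have h1 : bentGraph xp xq yq m k r - k * √(1 + r ^ 2) =
      yq + m * (max xq (min xp r) - xq) +
        k * (max (r - xp) 0 + max (xq - r) 0 - √(1 + r ^ 2)) := by
    unfold bentGraph; ring
  have h2 : |max xq (min xp r) - xq| ≤ xp - xq := by
    rw [abs_le]
    constructor
    · linarith [le_max_left xq (min xp r)]
    · linarith [max_le hpq.le (min_le_left xp r)]
  have h3 : |r| ≤ √(1 + r ^ 2) := Real.abs_le_sqrt (by linarith)
  have h4 : √(1 + r ^ 2) ≤ |r| + 1 := by
    rw [Real.sqrt_le_left (by positivity)]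
    nlinarith [sq_abs r, abs_nonneg r]
  have h5 : |max (r - xp) 0 + max (xq - r) 0 - √(1 + r ^ 2)| ≤ |xp| + |xq| + 1 := by
    have := abs_le.1 (le_refl |xp|)
    have := abs_le.1 (le_refl |xq|)
    rw [abs_le]
    rcases max_cases (r - xp) 0 with ⟨e1, e1'⟩ | ⟨e1, e1'⟩ <;>
    rcases max_cases (xq - r) 0 with ⟨e2, e2'⟩ | ⟨e2, e2'⟩ <;>
    rcases abs_cases r with ⟨e3, e3'⟩ | ⟨e3, e3'⟩ <;>
    rw [e1, e2] <;> constructor <;> linarith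
  rw [h1]
  refine (abs_add_three _ _ _).trans ?_
  rw [abs_mul, abs_mul]
  gcongr

end bentGraph

/-- The parts of the bent graph over the two unbounded intervals are rays. -/
lemma framePoint_bentGraph_right {e p u : Plane} (he : ‖e‖ = 1) {a b xq yq m r : ℝ} (ha : 0 < a)
    (hXu : frameX e u = a) (hYu : frameY e u = b) (hpq : xq < frameX e p)
    (hm : yq + m * (frameX e p - xq) = frameY e p) (hr : frameX e p ≤ r) :
    framePoint e r (bentGraph (frameX e p) xq yq m (b / a) r) =
      p + ((r - frameX e p) / a) • u := by
  apply frame_ext he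
  · rw [frameX_framePoint he, frameX_add, frameX_smul, hXu]; field_simp; ring
  · rw [frameY_framePoint he, frameY_add, frameY_smul, hYu, bentGraph_right hpq hr, hm]
    field_simp

lemma framePoint_bentGraph_left {e q v : Plane} (he : ‖e‖ = 1) {a b xp m r : ℝ} (ha : 0 < a)
    (hXv : frameX e v = -a) (hYv : frameY e v = b) (hpq : frameX e q < xp)
    (hr : r ≤ frameX e q) :
    framePoint e r (bentGraph xp (frameX e q) (frameY e q) m (b / a) r) =
      q + ((frameX e q - r) / a) • v := by
  apply frame_ext he
  · rw [frameX_framePoint he, frameX_add, frameX_smul, hXv]; field_simp; ring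
  · rw [frameY_framePoint he, frameY_add, frameY_smul, hYv, bentGraph_left hpq hr]
    field_simp

lemma isTwoRaysJoinedBySegment_bentGraph {e p q u v : Plane} (he : ‖e‖ = 1) (hu : ‖u‖ = 1)
    (hv : ‖v‖ = 1) {a b m : ℝ} (ha : 0 < a) (hXu : frameX e u = a) (hXv : frameX e v = -a)
    (hYu : frameY e u = b) (hYv : frameY e v = b) (hpq : frameX e q < frameX e p)
    (hm : frameY e q + m * (frameX e p - frameX e q) = frameY e p) :
    IsTwoRaysJoinedBySegment
      (frameGraph e (bentGraph (frameX e p) (frameX e q) (frameY e q) m (b / a))) := by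
  set f := bentGraph (frameX e p) (frameX e q) (frameY e q) m (b / a) with hf
  have hrayp : ∀ x ∈ ray p u, frameX e p ≤ frameX e x ∧ (frameX e x ≤ frameX e p → x = p) := by
    rintro x ⟨s, hs, rfl⟩
    rw [frameX_add, frameX_smul, hXu]
    refine ⟨by nlinarith, fun h => ?_⟩
    have : s = 0 := by nlinarith
    simp [this]
  have hrayq : ∀ x ∈ ray q v, frameX e x ≤ frameX e q ∧ (frameX e q ≤ frameX e x → x = q) := by
    rintro x ⟨s, hs, rfl⟩
    rw [frameX_add, frameX_smul, hXv]
    refine ⟨by nlinarith, fun h => ?_⟩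
    have : s = 0 := by nlinarith
    simp [this]
  have hseg : ∀ x ∈ segment ℝ p q, frameX e q ≤ frameX e x ∧ frameX e x ≤ frameX e p ∧
      frameY e x = frameY e q + m * (frameX e x - frameX e q) := by
    rw [segment_eq_image']
    rintro x ⟨θ, ⟨h0, h1⟩, rfl⟩
    simp only [frameX_add, frameX_smul, frameX_sub, frameY_add, frameY_smul, frameY_sub]
    refine ⟨by nlinarith, by nlinarith, ?_⟩
    linear_combination (θ - 1) * hm
  have hpp : p ∈ ray p u := ⟨0, le_rfl, by simp⟩
  have hqq : q ∈ ray q v := ⟨0, le_rfl, by simp⟩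
  refine ⟨p, q, u, v, fun h => by simp [h] at hpq, hu, hv, ?_, ?_, ?_, ?_⟩
  · rw [Set.disjoint_left]
    intro x hx hx'
    linarith [(hrayp x hx).1, (hrayq x hx').1]
  · apply Subset.antisymm
    · rintro x ⟨h1, h2⟩
      exact (hrayp x h2).2 (hseg x h1).2.1
    · rintro x rfl
      exact ⟨left_mem_segment ℝ _ _, hpp⟩
  · apply Subset.antisymm
    · rintro x ⟨h1, h2⟩
      exact (hrayq x h2).2 (hseg x h1).1
    · rintro x rfl
      exact ⟨right_mem_segment ℝ _ _, hqq⟩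
  · apply Subset.antisymm
    · intro x hx
      rw [mem_frameGraph_iff he] at hx
      rcases le_total (frameX e p) (frameX e x) with h1 | h1
      · refine Or.inl (Or.inl ⟨(frameX e x - frameX e p) / a,
          div_nonneg (by linarith) ha.le, ?_⟩)
        rw [← framePoint_bentGraph_right he ha hXu hYu hpq hm h1]
        exact hx.symm
      rcases le_total (frameX e x) (frameX e q) with h2 | h2
      · refine Or.inr ⟨(frameX e q - frameX e x) / a, div_nonneg (by linarith) ha.le, ?_⟩
        rw [← framePoint_bentGraph_left he ha hXv hYv hpq h2]
        exact hx.symm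
      · refine Or.inl (Or.inr ?_)
        have hpos : 0 < frameX e p - frameX e q := by linarith
        rw [segment_eq_image']
        refine ⟨(frameX e p - frameX e x) / (frameX e p - frameX e q),
          ⟨div_nonneg (by linarith) hpos.le, (div_le_one hpos).2 (by linarith)⟩, ?_⟩
        have hY : frameY e x = frameY e q + m * (frameX e x - frameX e q) := by
          rw [← bentGraph_middle (k := b / a) h2 h1]
          rw [← hx, frameY_framePoint he, frameX_framePoint he]
        apply frame_ext he
        · simp only [frameX_add, frameX_smul, frameX_sub]
          field_simp
          ring
        · simp only [frameY_add, frameY_smul, frameY_sub]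
          rw [hY, ← hm]
          field_simp
          ring
    · have key : ∀ r, ∀ x, framePoint e r (f r) = x → x ∈ frameGraph e f := by
        rintro r x rfl
        exact framePoint_mem_frameGraph he f r
      rintro x ((⟨s, hs, rfl⟩ | hx) | ⟨s, hs, rfl⟩)
      · apply key (frameX e p + s * a)
        rw [framePoint_bentGraph_right he ha hXu hYu hpq hm (by nlinarith), add_sub_cancel_left,
          mul_div_cancel_right₀ _ ha.ne']
      · obtain ⟨h1, h2, h3⟩ := hseg x hx
        change frameY e x = f (frameX e x)
        rw [h3, hf, bentGraph_middle h1 h2]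
      · apply key (frameX e q - s * a)
        rw [framePoint_bentGraph_left he ha hXv hYv hpq (by nlinarith), sub_sub_cancel,
          mul_div_cancel_right₀ _ ha.ne']

/-- A union of discs about the points of a ray contains discs about the points of a shorter ray
whose radius grows with the abscissa. -/
lemma ball_subset_of_tail {S : Set Plane} {p u : Plane} {β₀ β : ℝ} (hβ : 0 < β) (hβ1 : β ≤ 1)
    (hββ₀ : β ≤ β₀) (hS : ∀ s, 2 ≤ s → Metric.closedBall (p + s • u) (s ^ β₀ / 2) ⊆ S)
    {s₁ s r : ℝ} (hs₁ : 2 ≤ s₁) (hr : 0 ≤ r) (hs : r / 2 ≤ s) (x : Plane)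
    (hx : x = p + s₁ • u + s • u) :
    Metric.ball x (1 / 4 * r ^ β) ⊆ S := by
  have hx' : x = p + (s₁ + s) • u := by rw [hx, add_smul, add_assoc]
  refine subset_trans ?_ (hS (s₁ + s) (by linarith))
  rw [hx']
  refine Metric.ball_subset_closedBall.trans (Metric.closedBall_subset_closedBall ?_)
  have h1 : (s₁ + s) ^ β ≤ (s₁ + s) ^ β₀ :=
    Real.rpow_le_rpow_of_exponent_le (by linarith) hββ₀
  have h2 : (r / 2) ^ β ≤ (s₁ + s) ^ β := by gcongr; linarith
  have h3 : r ^ β / 2 ≤ r ^ β / 2 ^ β := by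
    gcongr
    exact Real.rpow_le_self_of_one_le one_le_two hβ1
  rw [← Real.div_rpow hr zero_le_two] at h3
  linarith

/-- If `U` and its complement contain parabolic regions, then two rays along their axes, joined by
a segment, form the graph of a function in a suitable frame. -/
lemma exists_graph_of_parabolicRegions {U : Set Plane}
    (hU : ∃ P : Set Plane, IsParabolicRegion P ∧ P ⊆ U)
    (hUc : ∃ P : Set Plane, IsParabolicRegion P ∧ P ⊆ Uᶜ) :
    ∃ (e : Plane) (f : ℝ → ℝ) (k C c β R : ℝ), ‖e‖ = 1 ∧ Continuous f ∧
      (∀ r, |f r - k * √(1 + r ^ 2)| ≤ C) ∧ 0 < c ∧ 0 < β ∧ β ≤ 1 ∧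
      (∀ r, R ≤ r → Metric.ball (framePoint e r (f r)) (c * |r| ^ β) ⊆ U) ∧
      (∀ r, r ≤ -R → Metric.ball (framePoint e r (f r)) (c * |r| ^ β) ⊆ Uᶜ) ∧
      IsTwoRaysJoinedBySegment (frameGraph e f) := by
  obtain ⟨P, hP, hPU⟩ := hU
  obtain ⟨Q, hQ, hQU⟩ := hUc
  obtain ⟨p, u, β₁, hu, hβ₁, hβ₁1, hp⟩ := hP.exists_closedBall_subset
  obtain ⟨q, v, β₂, hv, hβ₂, hβ₂1, hq⟩ := hQ.exists_closedBall_subset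
  have hp' := fun s hs => (hp s hs).trans hPU
  have hq' := fun s hs => (hq s hs).trans hQU
  obtain ⟨e, a, b, he, ha, ha1, hXu, hXv, hYu, hYv⟩ :=
    exists_symmetric_frame hu hv (ne_of_disjoint_tails hβ₁ hp' hq')
  -- Along the axes the abscissas separate at rate `2 * a`. Starting at `s₁` puts `p₁` to the right
  -- of `q₁`, and `2 ≤ s₁` keeps the rays where the discs are available.
  set s₁ := max 2 ((|frameX e q - frameX e p| + 1) / a) with hs₁
  have hs₁2 : 2 ≤ s₁ := le_max_left _ _
  have hs₁a : |frameX e q - frameX e p| + 1 ≤ s₁ * a := by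
    rw [← div_le_iff₀ ha]; exact le_max_right _ _
  set p₁ := p + s₁ • u with hp₁
  set q₁ := q + s₁ • v with hq₁
  have hpq : frameX e q₁ < frameX e p₁ := by
    rw [hp₁, hq₁, frameX_add, frameX_add, frameX_smul, frameX_smul, hXu, hXv]
    linarith [le_abs_self (frameX e q - frameX e p), abs_nonneg (frameX e q - frameX e p)]
  set m := (frameY e p₁ - frameY e q₁) / (frameX e p₁ - frameX e q₁) with hmdef
  have hm : frameY e q₁ + m * (frameX e p₁ - frameX e q₁) = frameY e p₁ := by
    have : frameX e p₁ - frameX e q₁ ≠ 0 := by linarith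
    rw [hmdef]; field_simp; ring
  have hβ : 0 < min β₁ β₂ := lt_min hβ₁ hβ₂
  have hβ1 : min β₁ β₂ ≤ 1 := (min_le_left _ _).trans hβ₁1
  have hR1 := le_abs_self (frameX e p₁)
  have hR1' := neg_abs_le (frameX e p₁)
  have hR2 := le_abs_self (frameX e q₁)
  have hR2' := neg_abs_le (frameX e q₁)
  refine ⟨e, bentGraph (frameX e p₁) (frameX e q₁) (frameY e q₁) m (b / a), b / a, _, 1 / 4,
    min β₁ β₂, 2 * |frameX e p₁| + 2 * |frameX e q₁|, he, continuous_bentGraph _ _ _ _ _,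
    fun r => abs_bentGraph_sub_le hpq, by norm_num, hβ, hβ1, fun r hr => ?_, fun r hr => ?_,
    isTwoRaysJoinedBySegment_bentGraph he hu hv ha hXu hXv hYu hYv hpq hm⟩
  · have hr0 : 0 ≤ r := by
      linarith [abs_nonneg (frameX e p₁), abs_nonneg (frameX e q₁)]
    rw [abs_of_nonneg hr0]
    -- The ray parameter is at least `r / 2` because `a ≤ 1` and `r ≥ 2 * |frameX e p₁|`.
    refine ball_subset_of_tail hβ hβ1 (min_le_left _ _) hp' hs₁2 hr0
      (s := (r - frameX e p₁) / a) ?_ _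
      (framePoint_bentGraph_right he ha hXu hYu hpq hm (by linarith [abs_nonneg (frameX e q₁)]))
    rw [le_div_iff₀ ha]
    nlinarith [abs_nonneg (frameX e q₁)]
  · have hr0 : r ≤ 0 := by
      linarith [abs_nonneg (frameX e p₁), abs_nonneg (frameX e q₁)]
    rw [abs_of_nonpos hr0]
    refine ball_subset_of_tail hβ hβ1 (min_le_right _ _) hq' hs₁2 (neg_nonneg.2 hr0)
      (s := (frameX e q₁ - r) / a) ?_ _
      (framePoint_bentGraph_left he ha hXv hYv hpq (by linarith [abs_nonneg (frameX e p₁)]))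
    rw [le_div_iff₀ ha]
    nlinarith [abs_nonneg (frameX e p₁)]

theorem proposition2 (U : Set Plane)
    (hU : ∃ P : Set Plane, IsParabolicRegion P ∧ P ⊆ U)
    (hUc : ∃ P : Set Plane, IsParabolicRegion P ∧ P ⊆ Uᶜ) :
    ∃ V : Set Plane,
      Transverse U V ∧
      IsTwoRaysJoinedBySegment (frontier V) ∧
      (∃! k : ℤ, HasIntersectionNumber U V k) ∧
      intersectionNumber U V = -1 := by
  obtain ⟨e, f, k, C, c, β, R, he, hf, hfg, hc, hβ, hβ1, hpos, hneg, hΓ⟩ :=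
    exists_graph_of_parabolicRegions hU hUc
  have hlin : ∀ r, |f r| ≤ |k| * |r| + (|k| + C) := fun r => by
    have h1 := abs_mul_sqrt_le k r
    have h2 := abs_sub_abs_le_abs_sub (f r) (k * √(1 + r ^ 2))
    linarith [hfg r]
  have hgrow : Tendsto (fun r : ℝ => c * r ^ β) atTop atTop :=
    (tendsto_rpow_atTop hβ).const_mul_atTop hc
  -- For uniqueness, discs of radius 2 suffice: each contains a lattice point within 1 of its
  -- centre.
  obtain ⟨R', hR'⟩ := ((hgrow.eventually_ge_atTop 2).and
    ((eventually_ge_atTop R).and (eventually_ge_atTop 0))).exists_forall_of_atTop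
  have hpos' : ∀ r, R' ≤ r → Metric.ball (framePoint e r (f r)) 2 ⊆ U := fun r hr => by
    obtain ⟨h1, h2, h3⟩ := hR' r hr
    refine (Metric.ball_subset_ball ?_).trans (hpos r h2)
    rwa [abs_of_nonneg h3]
  have hneg' : ∀ r, r ≤ -R' → Metric.ball (framePoint e r (f r)) 2 ⊆ Uᶜ := fun r hr => by
    obtain ⟨h1, h2, h3⟩ := hR' (-r) (by linarith)
    refine (Metric.ball_subset_ball ?_).trans (hneg r (by linarith))
    rwa [abs_of_nonpos (by linarith)]
  have hex := hasIntersectionNumber_neg_one he hf hlin hc hβ hβ1 hpos hneg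
  have huniq : ∀ n, HasIntersectionNumber U (frameEpigraph e f) n → n = -1 := fun n hn =>
    hn.eq_neg_one he hf hfg hpos' hneg'
  refine ⟨frameEpigraph e f, ?_, ?_, ⟨-1, hex, huniq⟩, ?_⟩
  · have hmem : ∀ r, framePoint e r (f r) ∈ Metric.ball (framePoint e r (f r)) 2 := fun r =>
      Metric.mem_ball_self two_pos
    refine transverse_frameEpigraph (R := R) ?_ he hf hlin hc hβ hβ1 ?_
    · refine nonempty_frontier_iff.2 ⟨⟨_, hpos' R' le_rfl (hmem R')⟩, fun h => ?_⟩
      exact hneg' (-R') le_rfl (hmem (-R')) (h ▸ mem_univ _)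
    -- An open disc contained in `U` or in `Uᶜ` contains no boundary point of `U`.
    · intro r hr z hz hball
      rcases le_abs.1 hr with h | h
      · exact hz.2 (interior_maximal (hpos r h) Metric.isOpen_ball hball)
      · rw [← frontier_compl] at hz
        exact hz.2 (interior_maximal (hneg r (by linarith)) Metric.isOpen_ball hball)
  · rwa [frontier_frameEpigraph he hf]
  · have h : ∃ n, HasIntersectionNumber U (frameEpigraph e f) n := ⟨-1, hex⟩
    rw [intersectionNumber, dif_pos h]
    exact huniq _ h.choose_spec
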